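/- Let $\Phi=\{x_i\}_{i\in\mathbb N}$ be a homogeneous Poisson point process of intensity $\lambda>0$ in $\mathbb{R}^2$, let $x\in\mathbb{R}^2$ (the receiver), let $\alpha>2$ and $0<\phi\le 2\pi$, and let the channel gains $h_i$ be almost surely positive i.i.d. copies of a random variable $h$, independent of $\Phi$, with $\bar h_{2/\alpha}=E[h^{2/\alpha}]<\infty$. The interferers are the nodes $x_i$ for which the angle in $[0,2\pi)$ of the vector $x_i-x$, measured counterclockwise from the positive horizontal axis, is at most $\phi$; the interference power of node $i$ is $I_i=h_i\|x-x_i\|^{-\alpha}$. Put $\Lambda_2(z)=\tfrac12\,\phi\lambda\,\bar h_{2/\alpha}\,z^{2/\alpha}$ for $z\ge 0$. Then almost surely the interference powers of the interferers are pairwise distinct and can be listed as a strictly decreasing infinite sequence $I_{(1)}>I_{(2)}>\cdots$, and for every $n\ge 1$ the random variable $z_n=I_{(n)}^{-1}$, the inverse of the $n$-th dominant interference power, has the probability density function $$f^{\phi}_{z_n}(z)=\frac{2\,e^{-\Lambda_2(z)}\,\Lambda_2(z)^n}{\alpha\, z\,(n-1)!}\quad (z>0),\qquad f^{\phi}_{z_n}(z)=0\quad(z\le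 0).$$ Moreover, the points $\|x_i-x\|^{\alpha}/h_i$, taken over the interferers, form a Poisson point process on $\mathbb{R}^+$ whose intensity measure has density $\tfrac{\phi\lambda}{\alpha}\bar h_{2/\alpha}z^{2/\alpha-1}$, and so assigns to $[0,z]$ the mass $\Lambda_2(z)$ for every $z\ge 0$. -/

import Mathlib

open MeasureTheory ProbabilityTheory
open scoped ENNReal

noncomputable section

/-- The random counting measure `N` is a Poisson point process with intensity measure `ν`:
the number of points in a measurable set `B` of finite intensity is Poisson distributed with mean
`ν B`, and the numbers of points in finitely many pairwise disjoint such sets are independent. -/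
structure IsPoissonPointProcess {Ω E : Type*} [MeasurableSpace Ω] [MeasurableSpace E]
    (N : Ω → Measure E) (ν : Measure E) (P : Measure Ω) : Prop where
  hasLaw_count : ∀ B : Set E, MeasurableSet B → ν B < ∞ →
    HasLaw (fun ω => N ω B)
      ((poissonMeasure (ν B).toNNReal).map (fun k : ℕ => (k : ℝ≥0∞))) P
  iIndepFun_count : ∀ (k : ℕ) (B : Fin k → Set E),
    (∀ j, MeasurableSet (B j)) → (∀ j, ν (B j) < ∞) → Pairwise (fun i j => Disjoint (B i) (B j)) →
    iIndepFun (fun j ω => N ω (B j)) P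

/-- The counting measure of a family of points (multiplicities are counted). -/
def countingMeasure {ι E : Type*} [MeasurableSpace E] (p : ι → E) : Measure E :=
  Measure.sum fun i => Measure.dirac (p i)

/-- The angle in `[0, 2π)` of a planar vector, measured counterclockwise from the positive
horizontal axis. -/
def directionAngle (v : EuclideanSpace ℝ (Fin 2)) : ℝ :=
  toIcoMod Real.two_pi_pos 0 (Complex.arg ⟨v 0, v 1⟩)

/-- The indices of the nodes seen by a receiver at `x` within the reception angle `φ`. -/
def interferers (φ : ℝ) (x : EuclideanSpace ℝ (Fin 2))
    (X : ℕ → EuclideanSpace ℝ (Fin 2)) : Set ℕ :=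
  {i | directionAngle (X i - x) ≤ φ}

/-- The interference power received at `x` from a node at `y` with channel gain `g`, for the
path-loss exponent `α`. -/
def interferencePower (α : ℝ) (x y : EuclideanSpace ℝ (Fin 2)) (g : ℝ) : ℝ :=
  g * ‖x - y‖ ^ (-α)

/-- The `n`-th largest value (`n ≥ 1`, with multiplicity) of the family `(a i)`, `i ∈ S`: the
largest threshold that is reached by at least `n` members of the family. -/
def nthLargest {ι : Type*} (S : Set ι) (a : ι → ℝ) (n : ℕ) : ℝ :=
  sSup {t : ℝ | (n : ℕ∞) ≤ {i | i ∈ S ∧ t ≤ a i}.encard}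

/-- The `n`-th dominant interference power at a receiver at `x` with reception angle `φ`, for
nodes at the points `X i` with channel gains `h i`. -/
def dominantPower (α φ : ℝ) (x : EuclideanSpace ℝ (Fin 2))
    (X : ℕ → EuclideanSpace ℝ (Fin 2)) (h : ℕ → ℝ) (n : ℕ) : ℝ :=
  nthLargest (interferers φ x X) (fun i => interferencePower α x (X i) (h i)) n

/-- The point configuration `{‖X i - x‖ ^ α / h i}` on the power axis, over the interferers `i`. -/
def powerAxisProcess (α φ : ℝ) (x : EuclideanSpace ℝ (Fin 2))
    (X : ℕ → EuclideanSpace ℝ (Fin 2)) (h : ℕ → ℝ) : Measure ℝ :=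
  countingMeasure fun i : interferers φ x X => ‖X i - x‖ ^ α / h i

/-- `Λ₂(z) = (φ λ / 2) m z ^ (2 / α)`, where `m` is the moment of order `2 / α` of the gain. -/
def cumulativeIntensity (lam α φ m z : ℝ) : ℝ :=
  φ * lam / 2 * m * z ^ (2 / α)

/-- The measure on the positive half-line with density `(φ λ / α) m z ^ (2 / α - 1)`. -/
def powerAxisIntensity (lam α φ m : ℝ) : Measure ℝ :=
  (volume.restrict (Set.Ioi 0)).withDensity
    fun z => ENNReal.ofReal (φ * lam / α * m * z ^ (2 / α - 1))

/-- The probability density of the inverse of the `n`-th dominant interference power. -/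
def inverseDominantPDF (lam α φ m : ℝ) (n : ℕ) (z : ℝ) : ℝ :=
  if 0 < z then
    2 * Real.exp (-cumulativeIntensity lam α φ m z) * cumulativeIntensity lam α φ m z ^ n /
      (α * z * (Nat.factorial (n - 1) : ℝ))
  else 0

end

/-!
Averaging `exp (-∫ u dN)` over independent marks turns a test function `u (y, g)` into
`U y = -log 𝔼 [exp (-u (y, g))]`, and the Laplace functional of a Poisson process at `U` is that of
a Poisson process with intensity `ν ⊗ μ` at `u`. As the Laplace functional determines a point
process, the marked nodes `(xᵢ, hᵢ)` form a Poisson process; restricting it to the sector and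
mapping it by `(y, g) ↦ ‖y - x‖ ^ α / g` gives a Poisson process on the power axis. A sector of
radius `R` and angle `φ` has area `φ R² / 2`, so with `R = (z g) ^ (1 / α)`, averaged over the
gain `g`, the intensity of `[0, z]` is `Λ₂ z`.

Since `Λ₂` is finite, diffuse and unbounded, the points on the power axis are almost surely
locally finite, distinct and infinitely many, so the interference powers can be ranked, and
`Zₙ ≤ z` means that `[0, z]` contains at least `n` points. The density of `Zₙ` is therefore the
derivative of the Poisson tail `1 - ∑_{k < n} exp (-Λ₂ z) (Λ₂ z) ^ k / k!`, whose sum telescopes.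
-/

open scoped NNReal

/-- The function `a ↦ e⁻ᵃ` on `[0, ∞]`, in which Laplace functionals are written so that infinite
counts are allowed. -/
noncomputable def expNeg (a : ℝ≥0∞) : ℝ≥0∞ := EReal.exp (-(a : EReal))

@[fun_prop]
lemma continuous_expNeg : Continuous expNeg :=
  ENNReal.continuous_exp.comp (continuous_neg.comp continuous_coe_ennreal_ereal)

@[fun_prop]
lemma measurable_expNeg : Measurable expNeg := continuous_expNeg.measurable

lemma antitone_expNeg : Antitone expNeg := fun _ _ hab =>
  EReal.exp_monotone (EReal.neg_le_neg_iff.2 (EReal.coe_ennreal_le_coe_ennreal_iff.2 hab))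

@[simp] lemma expNeg_zero : expNeg 0 = 1 := by simp [expNeg]

@[simp] lemma expNeg_top : expNeg ∞ = 0 := by simp [expNeg]

lemma expNeg_injective : Function.Injective expNeg := fun a b hab => by
  simpa using EReal.exp_strictMono.injective hab

lemma expNeg_ofReal {r : ℝ} (hr : 0 ≤ r) :
    expNeg (ENNReal.ofReal r) = ENNReal.ofReal (Real.exp (-r)) := by
  rw [expNeg, EReal.coe_ennreal_ofReal, max_eq_left hr, ← EReal.coe_neg, EReal.exp_coe]

lemma expNeg_le_one (a : ℝ≥0∞) : expNeg a ≤ 1 := by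
  simpa using antitone_expNeg (zero_le : 0 ≤ a)

lemma expNeg_ne_top (a : ℝ≥0∞) : expNeg a ≠ ∞ :=
  ne_top_of_le_ne_top ENNReal.one_ne_top (expNeg_le_one a)

lemma expNeg_add (a b : ℝ≥0∞) : expNeg (a + b) = expNeg a * expNeg b := by
  rw [expNeg, expNeg, expNeg, ← EReal.exp_add, EReal.coe_ennreal_add,
    EReal.neg_add (.inl (EReal.coe_ennreal_ne_bot a)) (.inr (EReal.coe_ennreal_ne_bot b)),
    sub_eq_add_neg]

lemma expNeg_sum {ι : Type*} (s : Finset ι) (f : ι → ℝ≥0∞) :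
    expNeg (∑ i ∈ s, f i) = ∏ i ∈ s, expNeg (f i) := by
  classical
  induction s using Finset.induction_on with
  | empty => simp
  | insert a s ha ih => rw [Finset.sum_insert ha, Finset.prod_insert ha, expNeg_add, ih]

lemma expNeg_mul_natCast (c : ℝ≥0∞) (k : ℕ) : expNeg (c * k) = expNeg c ^ k := by
  simpa [mul_comm] using expNeg_sum (Finset.range k) fun _ => c

/-- The function `p ↦ -log p`, inverse to `expNeg` on `[0, 1]`, with the value `0` for `p ≥ 1`. -/
noncomputable def negLog (p : ℝ≥0∞) : ℝ≥0∞ := (-(ENNReal.log p)).toENNReal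

@[fun_prop]
lemma measurable_negLog : Measurable negLog :=
  measurable_ereal_toENNReal.comp (measurable_neg.comp ENNReal.measurable_log)

lemma expNeg_negLog {p : ℝ≥0∞} (hp : p ≤ 1) : expNeg (negLog p) = p := by
  have : 0 ≤ -(ENNReal.log p) := by
    rw [EReal.neg_nonneg]
    simpa using ENNReal.log_monotone hp
  rw [expNeg, negLog, EReal.coe_toENNReal this, neg_neg, ENNReal.exp_log]

lemma lintegral_expNeg_le_one {Ω : Type*} [MeasurableSpace Ω] (P : Measure Ω)
    [IsProbabilityMeasure P] (f : Ω → ℝ≥0∞) : ∫⁻ ω, expNeg (f ω) ∂P ≤ 1 :=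
  (lintegral_mono fun ω => expNeg_le_one (f ω)).trans_eq (by simp)

lemma lintegral_pow_poissonMeasure (r : ℝ≥0) {q : ℝ≥0∞} (hq : q ≤ 1) :
    ∫⁻ k, q ^ k ∂(poissonMeasure r) = expNeg ((1 - q) * r) := by
  lift q to ℝ≥0 using ne_top_of_le_ne_top ENNReal.one_ne_top hq
  have hq' : 0 ≤ 1 - (q : ℝ) := sub_nonneg.2 (by exact_mod_cast hq)
  have hsum : HasSum (fun n : ℕ => Real.exp (-r) * (r : ℝ) ^ n / n.factorial * (q : ℝ) ^ n)
      (Real.exp (-((1 - q) * r))) := by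
    have h := (NormedSpace.expSeries_div_hasSum_exp ((r : ℝ) * q)).mul_left (Real.exp (-r))
    rw [← Real.exp_eq_exp_ℝ, ← Real.exp_add] at h
    convert! h using 1
    · ext n; rw [mul_pow]; ring
    · congr 1; ring
  have hcoe : ((1 - q : ℝ≥0∞) * r) = ENNReal.ofReal ((1 - q) * r) := by
    rw [ENNReal.ofReal_mul hq', ENNReal.ofReal_sub _ q.coe_nonneg]
    simp
  rw [hcoe, expNeg_ofReal (by positivity), ← hsum.tsum_eq,
    ENNReal.ofReal_tsum_of_nonneg (fun n => by positivity) hsum.summable, poissonMeasure,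
    lintegral_sum_measure]
  refine tsum_congr fun n => ?_
  rw [lintegral_smul_measure, lintegral_dirac, ENNReal.ofReal_mul (by positivity),
    ENNReal.ofReal_pow q.coe_nonneg]
  simp

lemma lintegral_expNeg_mul_poissonMeasure (c : ℝ≥0∞) (r : ℝ≥0) :
    ∫⁻ a, expNeg (c * a) ∂((poissonMeasure r).map (fun k : ℕ => (k : ℝ≥0∞))) =
      expNeg ((1 - expNeg c) * r) := by
  rw [lintegral_map (by fun_prop) (by fun_prop)]
  simp_rw [expNeg_mul_natCast]
  exact lintegral_pow_poissonMeasure r (expNeg_le_one c)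

section LaplaceFunctional

variable {Ω E : Type*} [MeasurableSpace Ω] [MeasurableSpace E]

/-- The Laplace functional `u ↦ 𝔼[exp (-∫ u dN)]` of a random measure `N`. -/
noncomputable def laplaceFunctional (N : Ω → Measure E) (P : Measure Ω) (u : E → ℝ≥0∞) : ℝ≥0∞ :=
  ∫⁻ ω, expNeg (∫⁻ y, u y ∂(N ω)) ∂P

lemma tendsto_laplaceFunctional {N : Ω → Measure E} (hNm : Measurable N) {P : Measure Ω}
    [IsFiniteMeasure P] {f : ℕ → E → ℝ≥0∞} {u : E → ℝ≥0∞} (hfm : ∀ n, Measurable (f n))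
    (hmono : ∀ y, Monotone fun n => f n y)
    (hlim : ∀ y, Filter.Tendsto (fun n => f n y) Filter.atTop (nhds (u y))) :
    Filter.Tendsto (fun n => laplaceFunctional N P (f n)) Filter.atTop
      (nhds (laplaceFunctional N P u)) := by
  refine tendsto_lintegral_of_dominated_convergence (fun _ => 1) (fun n => ?_)
    (fun n => ae_of_all _ fun ω => expNeg_le_one _) (by simp) (ae_of_all _ fun ω => ?_)
  · exact measurable_expNeg.comp ((Measure.measurable_lintegral (hfm n)).comp hNm)
  · exact (continuous_expNeg.tendsto _).comp (lintegral_tendsto_of_tendsto_of_monotone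
      (fun n => (hfm n).aemeasurable) (ae_of_all _ hmono) (ae_of_all _ hlim))

lemma tendsto_expNeg_lintegral_one_sub_expNeg (ν : Measure E) {f : ℕ → E → ℝ≥0∞}
    {u : E → ℝ≥0∞} (hfm : ∀ n, Measurable (f n)) (hmono : ∀ y, Monotone fun n => f n y)
    (hlim : ∀ y, Filter.Tendsto (fun n => f n y) Filter.atTop (nhds (u y))) :
    Filter.Tendsto (fun n => expNeg (∫⁻ y, (1 - expNeg (f n y)) ∂ν)) Filter.atTop
      (nhds (expNeg (∫⁻ y, (1 - expNeg (u y)) ∂ν))) := by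
  refine (continuous_expNeg.tendsto _).comp (lintegral_tendsto_of_tendsto_of_monotone
    (fun n => ?_) (ae_of_all _ fun y m n hmn => ?_) (ae_of_all _ fun y => ?_))
  · exact (measurable_const.sub (measurable_expNeg.comp (hfm n))).aemeasurable
  · exact tsub_le_tsub_left (antitone_expNeg (hmono y hmn)) 1
  · exact ENNReal.Tendsto.sub tendsto_const_nhds ((continuous_expNeg.tendsto _).comp (hlim y))
      (.inl ENNReal.one_ne_top)

lemma exists_monotone_simpleFunc_tendsto (ν : Measure E) [SigmaFinite ν]
    {u : E → ℝ≥0∞} (hu : Measurable u) :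
    ∃ f : ℕ → SimpleFunc E ℝ≥0∞, (∀ n, ν (Function.support (f n)) < ∞) ∧
      (∀ y, Monotone fun n => f n y) ∧
      ∀ y, Filter.Tendsto (fun n => f n y) Filter.atTop (nhds (u y)) := by
  refine ⟨fun n => (SimpleFunc.eapprox u n).restrict (spanningSets ν n), fun n => ?_,
    fun y m n hmn => ?_, fun y => ?_⟩
  · rw [SimpleFunc.coe_restrict _ (measurableSet_spanningSets ν n)]
    exact (measure_mono Set.support_indicator_subset).trans_lt (measure_spanningSets_lt_top ν n)
  · simp only [SimpleFunc.restrict_apply _ (measurableSet_spanningSets ν _)]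
    exact (Set.indicator_le_indicator_of_subset (monotone_spanningSets ν hmn)
      (fun _ => zero_le) y).trans
      (Set.indicator_le_indicator (SimpleFunc.monotone_eapprox u hmn y))
  · refine (SimpleFunc.tendsto_eapprox hu y).congr' ?_
    filter_upwards [Filter.eventually_ge_atTop (spanningSetsIndex ν y)] with n hn
    rw [SimpleFunc.restrict_apply _ (measurableSet_spanningSets ν n), Set.indicator_of_mem
      (monotone_spanningSets ν hn (mem_spanningSetsIndex ν y))]

lemma lintegral_comp_simpleFunc_eq_sum (M : Measure E) (f : SimpleFunc E ℝ≥0∞)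
    {g : ℝ≥0∞ → ℝ≥0∞} (hg : g 0 = 0) :
    ∫⁻ y, g (f y) ∂M = ∑ c : f.range.erase 0, g c * M (f ⁻¹' {(c : ℝ≥0∞)}) := by
  rw [Finset.sum_coe_sort (f.range.erase 0) (fun c => g c * M (f ⁻¹' {c})),
    Finset.sum_erase _ (by rw [hg, zero_mul]), ← SimpleFunc.map_lintegral,
    ← SimpleFunc.lintegral_eq_lintegral, SimpleFunc.coe_map]
  rfl

namespace IsPoissonPointProcess

variable {N : Ω → Measure E} {ν : Measure E} {P : Measure Ω}

lemma lintegral_expNeg_mul_count (hN : IsPoissonPointProcess N ν P) (c : ℝ≥0∞)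
    {B : Set E} (hB : MeasurableSet B) (hB' : ν B < ∞) :
    ∫⁻ ω, expNeg (c * N ω B) ∂P = expNeg ((1 - expNeg c) * ν B) := by
  rw [(hN.hasLaw_count B hB hB').lintegral_comp (f := fun a => expNeg (c * a)) (by fun_prop),
    lintegral_expNeg_mul_poissonMeasure, ENNReal.coe_toNNReal hB'.ne]

lemma iIndepFun_count_of_finite (hN : IsPoissonPointProcess N ν P) {ι : Type*} [Finite ι]
    {B : ι → Set E} (hB : ∀ j, MeasurableSet (B j)) (hB' : ∀ j, ν (B j) < ∞)
    (hd : Pairwise fun i j => Disjoint (B i) (B j)) : iIndepFun (fun j ω => N ω (B j)) P := by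
  obtain ⟨k, ⟨e⟩⟩ := Finite.exists_equiv_fin ι
  refine iIndepFun.of_precomp e.symm.surjective ?_
  exact hN.iIndepFun_count k (fun j => B (e.symm j)) (fun j => hB _) (fun j => hB' _)
    fun i j hij => hd (e.symm.injective.ne hij)

lemma lintegral_expNeg_sum_count (hN : IsPoissonPointProcess N ν P) (hNm : Measurable N)
    {ι : Type*} [Fintype ι] {B : ι → Set E} (hB : ∀ j, MeasurableSet (B j))
    (hB' : ∀ j, ν (B j) < ∞) (hd : Pairwise fun i j => Disjoint (B i) (B j)) (c : ι → ℝ≥0∞) :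
    ∫⁻ ω, expNeg (∑ j, c j * N ω (B j)) ∂P = expNeg (∑ j, (1 - expNeg (c j)) * ν (B j)) := by
  have hind := (hN.iIndepFun_count_of_finite hB hB' hd).comp (fun j a => expNeg (c j * a))
    fun j => by fun_prop
  have hm : ∀ j, Measurable fun ω => expNeg (c j * N ω (B j)) := fun j =>
    measurable_expNeg.comp (((Measure.measurable_coe (hB j)).comp hNm).const_mul _)
  simp_rw [expNeg_sum]
  exact (lintegral_prod_eq_prod_lintegral_of_indepFun Finset.univ _ hind hm).trans
    (Finset.prod_congr rfl fun j _ => hN.lintegral_expNeg_mul_count (c j) (hB j) (hB' j))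

lemma laplaceFunctional_simpleFunc (hN : IsPoissonPointProcess N ν P) (hNm : Measurable N)
    (f : SimpleFunc E ℝ≥0∞) (hf : ν (Function.support f) < ∞) :
    laplaceFunctional N P f = expNeg (∫⁻ y, (1 - expNeg (f y)) ∂ν) := by
  have hfin : ∀ c : f.range.erase 0, ν (f ⁻¹' {(c : ℝ≥0∞)}) < ∞ := fun c =>
    (measure_mono fun y (hy : f y = c) => by
      simpa [hy] using (Finset.mem_erase.1 c.2).1).trans_lt hf
  have hint : ∀ ω, ∫⁻ y, f y ∂(N ω) = ∑ c : f.range.erase 0, c * N ω (f ⁻¹' {(c : ℝ≥0∞)}) :=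
    fun ω => lintegral_comp_simpleFunc_eq_sum (N ω) f (g := id) rfl
  rw [laplaceFunctional, lintegral_comp_simpleFunc_eq_sum ν f (g := fun c => 1 - expNeg c)
    (by simp)]
  simp_rw [hint]
  exact hN.lintegral_expNeg_sum_count hNm (fun c => f.measurableSet_preimage _) hfin
    (fun i j hij => .preimage _ (Set.disjoint_singleton.2 (Subtype.coe_injective.ne hij))) _

theorem laplaceFunctional_eq [IsFiniteMeasure P] [SigmaFinite ν]
    (hN : IsPoissonPointProcess N ν P) (hNm : Measurable N) {u : E → ℝ≥0∞} (hu : Measurable u) :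
    laplaceFunctional N P u = expNeg (∫⁻ y, (1 - expNeg (u y)) ∂ν) := by
  obtain ⟨f, hsupp, hmono, hlim⟩ := exists_monotone_simpleFunc_tendsto ν hu
  refine tendsto_nhds_unique
    (tendsto_laplaceFunctional hNm (fun n => (f n).measurable) hmono hlim) ?_
  simp_rw [hN.laplaceFunctional_simpleFunc hNm (f _) (hsupp _)]
  exact tendsto_expNeg_lintegral_one_sub_expNeg ν (fun n => (f n).measurable) hmono hlim

end IsPoissonPointProcess

end LaplaceFunctional

section Characterization

open BoundedContinuousFunction in
theorem ext_of_forall_mem_submonoid_integral_eq {E : Type*} [MeasurableSpace E]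
    [TopologicalSpace E] [PolishSpace E] [BorelSpace E] {μ ν : Measure E} [IsFiniteMeasure μ]
    [IsFiniteMeasure ν] (M : Submonoid (E →ᵇ ℝ)) (hM : ∀ a b, a ≠ b → ∃ g ∈ M, g a ≠ g b)
    (h : ∀ g ∈ M, ∫ a, g a ∂μ = ∫ a, g a ∂ν) : μ = ν := by
  -- the linear span of `M` is an algebra, so that Stone–Weierstrass applies to it
  let A : StarSubalgebra ℝ (E →ᵇ ℝ) :=
    { Algebra.adjoin ℝ (M : Set (E →ᵇ ℝ)) with
      star_mem' := fun {g} hg => by rwa [show star g = g by ext; simp] }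
  refine ext_of_forall_mem_subalgebra_integral_eq_of_polish (𝕜 := ℝ) (A := A) ?_ fun g hg => ?_
  · intro a b hab
    obtain ⟨g, hg, hne⟩ := hM a b hab
    exact ⟨g, ⟨g, ⟨g, Algebra.subset_adjoin hg, rfl⟩, rfl⟩, hne⟩
  · replace hg : g ∈ Submodule.span ℝ (M : Set (E →ᵇ ℝ)) := by
      rwa [← Submonoid.closure_eq M, ← Algebra.adjoin_eq_span]
    induction hg using Submodule.span_induction with
    | mem g hg => exact h g hg
    | zero => simp
    | add g₁ g₂ _ _ h₁ h₂ =>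
      simp only [coe_add, Pi.add_apply]
      rw [integral_add (g₁.integrable _) (g₂.integrable _),
        integral_add (g₁.integrable _) (g₂.integrable _), h₁, h₂]
    | smul c g _ hg =>
      simp only [coe_smul]
      rw [integral_smul, integral_smul, hg]

/-- The bounded continuous function `a ↦ exp (-∑ cⱼ aⱼ)` on `[0, ∞]^ι`. -/
noncomputable def expNegCombination {ι : Type*} [Fintype ι] (c : ι → ℕ) :
    BoundedContinuousFunction (ι → ℝ≥0∞) ℝ :=
  .mkOfCompact ⟨fun a => (expNeg (∑ j, c j * a j)).toReal,
    ENNReal.continuousOn_toReal.comp_continuous (by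
      refine continuous_expNeg.comp (continuous_finsetSum _ fun j _ => ?_)
      exact (ENNReal.continuous_const_mul (ENNReal.natCast_ne_top _)).comp (continuous_apply j))
      fun a => expNeg_ne_top _⟩

lemma expNegCombination_apply {ι : Type*} [Fintype ι] (c : ι → ℕ) (a : ι → ℝ≥0∞) :
    expNegCombination c a = (expNeg (∑ j, c j * a j)).toReal := rfl

lemma expNegCombination_add {ι : Type*} [Fintype ι] (c d : ι → ℕ) :
    expNegCombination (c + d) = expNegCombination c * expNegCombination d := by
  ext a
  simp [expNegCombination_apply, ← ENNReal.toReal_mul, ← expNeg_add, ← Finset.sum_add_distrib,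
    add_mul]

lemma integral_expNegCombination {ι : Type*} [Fintype ι] (c : ι → ℕ) (μ : Measure (ι → ℝ≥0∞)) :
    ∫ a, expNegCombination c a ∂μ = (∫⁻ a, expNeg (∑ j, c j * a j) ∂μ).toReal :=
  integral_toReal (measurable_expNeg.comp (by fun_prop)).aemeasurable
    (ae_of_all _ fun _ => (expNeg_ne_top _).lt_top)

lemma ext_of_lintegral_expNeg {ι : Type*} [Fintype ι] {μ ν : Measure (ι → ℝ≥0∞)}
    [IsFiniteMeasure μ] [IsFiniteMeasure ν]
    (h : ∀ c : ι → ℕ, ∫⁻ a, expNeg (∑ j, c j * a j) ∂μ = ∫⁻ a, expNeg (∑ j, c j * a j) ∂ν) :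
    μ = ν := by
  classical
  let M : Submonoid (BoundedContinuousFunction (ι → ℝ≥0∞) ℝ) :=
    { carrier := Set.range expNegCombination
      one_mem' := ⟨0, by ext a; simp [expNegCombination_apply]⟩
      mul_mem' := by
        rintro _ _ ⟨c, rfl⟩ ⟨d, rfl⟩
        exact ⟨c + d, expNegCombination_add c d⟩ }
  refine ext_of_forall_mem_submonoid_integral_eq M (fun a b hab => ?_) ?_
  · obtain ⟨j, hj⟩ := Function.ne_iff.1 hab
    refine ⟨expNegCombination (Pi.single j 1), ⟨_, rfl⟩, fun heq => hj ?_⟩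
    have hsum (a : ι → ℝ≥0∞) : ∑ i, ((Pi.single j 1 : ι → ℕ) i : ℝ≥0∞) * a i = a j := by
      simp [Pi.single_apply]
    rw [expNegCombination_apply, expNegCombination_apply, hsum, hsum,
      ENNReal.toReal_eq_toReal_iff' (expNeg_ne_top _) (expNeg_ne_top _)] at heq
    exact expNeg_injective heq
  · rintro _ ⟨c, rfl⟩
    rw [integral_expNegCombination, integral_expNegCombination, h c]

lemma one_sub_expNeg_sum_indicator {E ι : Type*} [Fintype ι] {B : ι → Set E}
    (hd : Pairwise fun i j => Disjoint (B i) (B j)) (c : ι → ℝ≥0∞) (y : E) :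
    1 - expNeg (∑ j, (B j).indicator (fun _ => c j) y) =
      ∑ j, (B j).indicator (fun _ => 1 - expNeg (c j)) y := by
  by_cases hy : ∃ i, y ∈ B i
  · obtain ⟨i, hi⟩ := hy
    have hn : ∀ j, j ≠ i → y ∉ B j := fun j hj hyj => Set.disjoint_left.1 (hd hj) hyj hi
    rw [Finset.sum_eq_single i (fun j _ hj => by simp [hn j hj]) (by simp),
      Finset.sum_eq_single i (fun j _ hj => by simp [hn j hj]) (by simp)]
    simp [hi]
  · push Not at hy
    simp [hy]

lemma lintegral_sum_indicator_const {E ι : Type*} [MeasurableSpace E] [Fintype ι]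
    (M : Measure E) {B : ι → Set E} (hB : ∀ j, MeasurableSet (B j)) (c : ι → ℝ≥0∞) :
    ∫⁻ y, ∑ j, (B j).indicator (fun _ => c j) y ∂M = ∑ j, c j * M (B j) := by
  rw [lintegral_finsetSum _ fun j _ => measurable_const.indicator (hB j)]
  simp_rw [lintegral_indicator_const (hB _)]

variable {Ω E : Type*} [MeasurableSpace Ω] [MeasurableSpace E] {P : Measure Ω}
  [IsProbabilityMeasure P] {N : Ω → Measure E} {ν : Measure E}

lemma lintegral_expNeg_sum_pi_poissonMeasure {ι : Type*} [Fintype ι] (r : ι → ℝ≥0)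
    (c : ι → ℝ≥0∞) :
    ∫⁻ a, expNeg (∑ j, c j * a j)
        ∂(Measure.pi fun j => (poissonMeasure (r j)).map (fun k : ℕ => (k : ℝ≥0∞))) =
      expNeg (∑ j, (1 - expNeg (c j)) * r j) := by
  have (j : ι) : IsProbabilityMeasure ((poissonMeasure (r j)).map (fun k : ℕ => (k : ℝ≥0∞))) :=
    Measure.isProbabilityMeasure_map (by fun_prop)
  have hm : ∀ j, Measurable fun a : ℝ≥0∞ => expNeg (c j * a) := fun j => by fun_prop
  simp_rw [expNeg_sum]
  rw [lintegral_prod_eq_prod_lintegral_of_indepFun _ _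
    (iIndepFun_pi fun j => (hm j).aemeasurable) fun j => (hm j).comp (measurable_pi_apply j)]
  refine Finset.prod_congr rfl fun j _ => ?_
  rw [← lintegral_expNeg_mul_poissonMeasure]
  exact (measurePreserving_eval (fun j => (poissonMeasure (r j)).map
    (fun k : ℕ => (k : ℝ≥0∞))) j).lintegral_comp (hm j)

lemma map_count_eq_pi_of_laplaceFunctional_eq (hNm : Measurable N)
    (hL : ∀ u : E → ℝ≥0∞, Measurable u →
      laplaceFunctional N P u = expNeg (∫⁻ y, (1 - expNeg (u y)) ∂ν))
    {ι : Type*} [Fintype ι] {B : ι → Set E} (hB : ∀ j, MeasurableSet (B j))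
    (hB' : ∀ j, ν (B j) < ∞) (hd : Pairwise fun i j => Disjoint (B i) (B j)) :
    P.map (fun ω j => N ω (B j)) =
      Measure.pi fun j => (poissonMeasure (ν (B j)).toNNReal).map (fun k : ℕ => (k : ℝ≥0∞)) := by
  have hm : Measurable fun ω j => N ω (B j) :=
    measurable_pi_lambda _ fun j => (Measure.measurable_coe (hB j)).comp hNm
  have : IsProbabilityMeasure (P.map fun ω j => N ω (B j)) :=
    Measure.isProbabilityMeasure_map hm.aemeasurable
  have (j : ι) : IsProbabilityMeasure
      ((poissonMeasure (ν (B j)).toNNReal).map (fun k : ℕ => (k : ℝ≥0∞))) :=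
    Measure.isProbabilityMeasure_map (by fun_prop)
  refine ext_of_lintegral_expNeg fun c => ?_
  have hcount := hL (fun y => ∑ j, (B j).indicator (fun _ => (c j : ℝ≥0∞)) y)
    (Finset.measurable_fun_sum _ fun j _ => measurable_const.indicator (hB j))
  simp_rw [laplaceFunctional, one_sub_expNeg_sum_indicator hd, lintegral_sum_indicator_const _ hB]
    at hcount
  rw [lintegral_map (by fun_prop) hm, hcount,
    lintegral_expNeg_sum_pi_poissonMeasure]
  simp_rw [ENNReal.coe_toNNReal (hB' _).ne]

theorem IsPoissonPointProcess.of_laplaceFunctional_eq (hNm : Measurable N)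
    (hL : ∀ u : E → ℝ≥0∞, Measurable u →
      laplaceFunctional N P u = expNeg (∫⁻ y, (1 - expNeg (u y)) ∂ν)) :
    IsPoissonPointProcess N ν P := by
  have hm : ∀ B : Set E, MeasurableSet B → AEMeasurable (fun ω => N ω B) P := fun B hB =>
    ((Measure.measurable_coe hB).comp hNm).aemeasurable
  have hlaw : ∀ B : Set E, MeasurableSet B → ν B < ∞ → P.map (fun ω => N ω B) =
      (poissonMeasure (ν B).toNNReal).map (fun k : ℕ => (k : ℝ≥0∞)) := by
    intro B hB hB'
    have (_ : Unit) : IsProbabilityMeasure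
        ((poissonMeasure (ν B).toNNReal).map (fun k : ℕ => (k : ℝ≥0∞))) :=
      Measure.isProbabilityMeasure_map (by fun_prop)
    have h := map_count_eq_pi_of_laplaceFunctional_eq hNm hL (B := fun _ : Unit => B)
      (fun _ => hB) (fun _ => hB') fun i j hij => (hij (Subsingleton.elim i j)).elim
    calc P.map (fun ω => N ω B)
        = (P.map fun ω (_ : Unit) => N ω B).map (Function.eval ()) :=
          (AEMeasurable.map_map_of_aemeasurable (measurable_pi_apply ()).aemeasurable
            (aemeasurable_pi_lambda _ fun _ => hm B hB)).symm
      _ = _ := by rw [h, (measurePreserving_eval _ ()).map_eq]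
  refine ⟨fun B hB hB' => ⟨hm B hB, hlaw B hB hB'⟩, fun k B hB hB' hd => ?_⟩
  rw [iIndepFun_iff_map_fun_eq_pi_map fun j => hm _ (hB j),
    map_count_eq_pi_of_laplaceFunctional_eq hNm hL hB hB' hd]
  simp_rw [hlaw _ (hB _) (hB' _)]

end Characterization

section CountingMeasure

variable {ι Ω E : Type*} [MeasurableSpace Ω] [MeasurableSpace E]

lemma countingMeasure_apply (p : ι → E) {B : Set E} (hB : MeasurableSet B) :
    countingMeasure p B = (p ⁻¹' B).encard := by
  rw [countingMeasure, Measure.sum_apply _ hB, ← ENNReal.tsum_set_one,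
    tsum_subtype (p ⁻¹' B) fun _ => (1 : ℝ≥0∞)]
  exact tsum_congr fun i => Measure.dirac_apply' _ hB

lemma lintegral_countingMeasure (p : ι → E) {f : E → ℝ≥0∞} (hf : Measurable f) :
    ∫⁻ y, f y ∂(countingMeasure p) = ∑' i, f (p i) := by
  rw [countingMeasure, lintegral_sum_measure]
  exact tsum_congr fun i => lintegral_dirac' _ hf

lemma measurable_countingMeasure [Countable ι] {X : ι → Ω → E} (hX : ∀ i, Measurable (X i)) :
    Measurable fun ω => countingMeasure fun i => X i ω := by
  refine Measure.measurable_of_measurable_coe _ fun s hs => ?_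
  simp only [countingMeasure, Measure.sum_apply _ hs]
  exact Measurable.tsum fun i =>
    (Measure.measurable_coe hs).comp (Measure.measurable_dirac.comp (hX i))

end CountingMeasure

namespace IsPoissonPointProcess

variable {Ω E F : Type*} [MeasurableSpace Ω] [MeasurableSpace E] [MeasurableSpace F]
  {P : Measure Ω} {N : Ω → Measure E} {ν : Measure E}

theorem restrict (hN : IsPoissonPointProcess N ν P) {S : Set E} (hS : MeasurableSet S) :
    IsPoissonPointProcess (fun ω => (N ω).restrict S) (ν.restrict S) P where
  hasLaw_count B hB hB' := by
    simp only [Measure.restrict_apply hB] at hB' ⊢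
    exact hN.hasLaw_count (B ∩ S) (hB.inter hS) hB'
  iIndepFun_count k B hB hB' hd := by
    simp only [Measure.restrict_apply (hB _)] at hB' ⊢
    exact hN.iIndepFun_count k _ (fun j => (hB j).inter hS) hB' fun i j hij =>
      (hd hij).mono Set.inter_subset_left Set.inter_subset_left

theorem map (hN : IsPoissonPointProcess N ν P) {f : E → F} (hf : Measurable f) :
    IsPoissonPointProcess (fun ω => (N ω).map f) (ν.map f) P where
  hasLaw_count B hB hB' := by
    simp only [Measure.map_apply hf hB] at hB' ⊢
    exact hN.hasLaw_count _ (hf hB) hB'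
  iIndepFun_count k B hB hB' hd := by
    simp only [Measure.map_apply hf (hB _)] at hB' ⊢
    exact hN.iIndepFun_count k _ (fun j => hf (hB j)) hB' fun i j hij => (hd hij).preimage f

end IsPoissonPointProcess

section Marking

variable {ι Ω E F : Type*} [Countable ι] [MeasurableSpace Ω] [MeasurableSpace E]
  [MeasurableSpace F] {P : Measure Ω} [IsProbabilityMeasure P] {ν : Measure E} {μ : Measure F}

lemma lintegral_expNeg_tsum {f : ι → Ω → ℝ≥0∞} (hf : ∀ i, Measurable (f i))
    (hindep : iIndepFun f P) :
    ∫⁻ ω, expNeg (∑' i, f i ω) ∂P = expNeg (∑' i, negLog (∫⁻ ω, expNeg (f i ω) ∂P)) := by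
  have hprod (s : Finset ι) : ∫⁻ ω, expNeg (∑ i ∈ s, f i ω) ∂P =
      expNeg (∑ i ∈ s, negLog (∫⁻ ω, expNeg (f i ω) ∂P)) := by
    simp_rw [expNeg_sum, expNeg_negLog (lintegral_expNeg_le_one P _)]
    exact lintegral_prod_eq_prod_lintegral_of_indepFun s _
      (hindep.comp (fun _ => expNeg) fun _ => measurable_expNeg)
      fun i => measurable_expNeg.comp (hf i)
  have hlim : Filter.Tendsto (fun s : Finset ι => ∫⁻ ω, expNeg (∑ i ∈ s, f i ω) ∂P)
      Filter.atTop (nhds (∫⁻ ω, expNeg (∑' i, f i ω) ∂P)) := by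
    refine tendsto_lintegral_filter_of_dominated_convergence (fun _ => 1)
      (.of_forall fun s => ?_) (.of_forall fun s => ae_of_all _ fun ω => expNeg_le_one _)
      (by simp) (ae_of_all _ fun ω => ?_)
    · exact measurable_expNeg.comp (Finset.measurable_fun_sum s fun i _ => hf i)
    · exact (continuous_expNeg.tendsto _).comp ENNReal.summable.hasSum
  simp_rw [hprod] at hlim
  exact tendsto_nhds_unique hlim
    ((continuous_expNeg.tendsto _).comp ENNReal.summable.hasSum)

lemma lintegral_comp_prodMk_of_indepFun {X : Ω → E} {Y : Ω → F} (hX : Measurable X)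
    (hY : Measurable Y) (hXY : IndepFun X Y P) {G : E × F → ℝ≥0∞} (hG : Measurable G) :
    ∫⁻ ω, G (X ω, Y ω) ∂P = ∫⁻ ω, ∫⁻ ω', G (X ω, Y ω') ∂P ∂P := by
  have : IsProbabilityMeasure (P.map Y) := Measure.isProbabilityMeasure_map hY.aemeasurable
  rw [← lintegral_map hG (hX.prodMk hY), (indepFun_iff_map_prod_eq_prod_map_map
      hX.aemeasurable hY.aemeasurable).1 hXY, lintegral_prod _ hG.aemeasurable,
    lintegral_map hG.lintegral_prod_right' hX]
  exact lintegral_congr fun ω => lintegral_map (hG.comp measurable_prodMk_left) hY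

variable {X : ι → Ω → E} {h : ι → Ω → F}

lemma lintegral_expNeg_tsum_marked (hXm : ∀ i, Measurable (X i)) (hhm : ∀ i, Measurable (h i))
    (hlaw : ∀ i, HasLaw (h i) μ P) (hindep : iIndepFun h P)
    (hXh : IndepFun (fun ω i => X i ω) (fun ω i => h i ω) P)
    {u : E × F → ℝ≥0∞} (hu : Measurable u) :
    ∫⁻ ω, expNeg (∑' i, u (X i ω, h i ω)) ∂P =
      ∫⁻ ω, expNeg (∑' i, negLog (∫⁻ g, expNeg (u (X i ω, g)) ∂μ)) ∂P := by
  have hG : Measurable fun p : (ι → E) × (ι → F) => expNeg (∑' i, u (p.1 i, p.2 i)) :=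
    measurable_expNeg.comp (.tsum fun i => hu.comp (by fun_prop))
  rw [lintegral_comp_prodMk_of_indepFun (measurable_pi_lambda _ hXm) (measurable_pi_lambda _ hhm)
    hXh hG]
  refine lintegral_congr fun ω => ?_
  have hui : ∀ i, Measurable fun g => u (X i ω, g) := fun i => hu.comp measurable_prodMk_left
  rw [lintegral_expNeg_tsum (f := fun i ω' => u (X i ω, h i ω')) (fun i => (hui i).comp (hhm i))
    (hindep.comp _ hui)]
  congr! 3 with i
  exact congrArg negLog
    ((hlaw i).lintegral_comp (measurable_expNeg.comp (hui i)).aemeasurable)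

variable [IsProbabilityMeasure μ] [SigmaFinite ν]

theorem IsPoissonPointProcess.marked
    (hX : IsPoissonPointProcess (fun ω => countingMeasure fun i => X i ω) ν P)
    (hXm : ∀ i, Measurable (X i)) (hhm : ∀ i, Measurable (h i))
    (hlaw : ∀ i, HasLaw (h i) μ P) (hindep : iIndepFun h P)
    (hXh : IndepFun (fun ω i => X i ω) (fun ω i => h i ω) P) :
    IsPoissonPointProcess (fun ω => countingMeasure fun i => (X i ω, h i ω)) (ν.prod μ) P := by
  refine .of_laplaceFunctional_eq
    (measurable_countingMeasure fun i => (hXm i).prodMk (hhm i)) fun u hu => ?_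
  -- averaging over the marks turns `u` into the test function `U` of the unmarked process
  let U : E → ℝ≥0∞ := fun y => negLog (∫⁻ g, expNeg (u (y, g)) ∂μ)
  have hum : Measurable fun p => expNeg (u p) := measurable_expNeg.comp hu
  have hU : Measurable U := measurable_negLog.comp hum.lintegral_prod_right'
  calc laplaceFunctional (fun ω => countingMeasure fun i => (X i ω, h i ω)) P u
      = ∫⁻ ω, expNeg (∑' i, U (X i ω)) ∂P := by
        simp_rw [laplaceFunctional, lintegral_countingMeasure _ hu]
        exact lintegral_expNeg_tsum_marked hXm hhm hlaw hindep hXh hu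
    _ = laplaceFunctional (fun ω => countingMeasure fun i => X i ω) P U := by
        simp_rw [laplaceFunctional, lintegral_countingMeasure _ hU]
    _ = expNeg (∫⁻ y, (1 - expNeg (U y)) ∂ν) :=
        hX.laplaceFunctional_eq (measurable_countingMeasure hXm) hU
    _ = expNeg (∫⁻ p, (1 - expNeg (u p)) ∂(ν.prod μ)) := by
        rw [lintegral_prod _ (by fun_prop)]
        congr 1
        refine lintegral_congr fun y => ?_
        have hle := lintegral_expNeg_le_one μ fun g => u (y, g)
        rw [expNeg_negLog hle, lintegral_sub (by fun_prop)
          (ne_top_of_le_ne_top ENNReal.one_ne_top hle) (ae_of_all _ fun g => expNeg_le_one _)]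
        simp

end Marking

lemma poissonMeasure_Ici (r : ℝ≥0) (n : ℕ) :
    poissonMeasure r (Set.Ici n) =
      ENNReal.ofReal (1 - ∑ k ∈ Finset.range n, Real.exp (-r) * (r : ℝ) ^ k / k.factorial) := by
  have hIio : poissonMeasure r ((Finset.range n : Finset ℕ) : Set ℕ) =
      ENNReal.ofReal (∑ k ∈ Finset.range n, Real.exp (-r) * (r : ℝ) ^ k / k.factorial) := by
    rw [← sum_measure_singleton, ENNReal.ofReal_sum_of_nonneg fun k _ => by positivity]
    exact Finset.sum_congr rfl fun k _ => poissonMeasure_singleton r k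
  have hcompl : Set.Ici n = ((Finset.range n : Finset ℕ) : Set ℕ)ᶜ := by ext k; simp
  rw [hcompl, prob_compl_eq_one_sub (Finset.measurableSet _), hIio,
    ENNReal.ofReal_sub _ (Finset.sum_nonneg fun k _ => by positivity), ENNReal.ofReal_one]

namespace IsPoissonPointProcess

variable {Ω E : Type*} [MeasurableSpace Ω] [MeasurableSpace E] {P : Measure Ω}
  {N : Ω → Measure E} {ν : Measure E} {B : Set E}

lemma measure_le_count (hN : IsPoissonPointProcess N ν P) (hB : MeasurableSet B)
    (hB' : ν B ≠ ∞) (n : ℕ) :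
    P {ω | (n : ℝ≥0∞) ≤ N ω B} = ENNReal.ofReal
      (1 - ∑ k ∈ Finset.range n, Real.exp (-(ν B).toReal) * (ν B).toReal ^ k / k.factorial) := by
  have hpre : (fun k : ℕ => (k : ℝ≥0∞)) ⁻¹' Set.Ici (n : ℝ≥0∞) = Set.Ici n := by
    ext k; simp
  rw [(hN.hasLaw_count B hB hB'.lt_top).measure_eq (p := fun a => (n : ℝ≥0∞) ≤ a)
    measurableSet_Ici]
  refine (Measure.map_apply (by fun_prop) measurableSet_Ici).trans ?_
  rw [hpre, poissonMeasure_Ici, ENNReal.coe_toNNReal_eq_toReal]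

lemma ae_count_ne_top (hN : IsPoissonPointProcess N ν P) (hB : MeasurableSet B)
    (hB' : ν B ≠ ∞) : ∀ᵐ ω ∂P, N ω B ≠ ∞ := by
  have hm : MeasurableSet {a : ℝ≥0∞ | a ≠ ∞} := (measurableSet_singleton ∞).compl
  rw [(hN.hasLaw_count B hB hB'.lt_top).ae_iff (p := fun a => a ≠ ∞) (measurableSet_setOfPred.1 hm),
    ae_map_iff (by fun_prop) hm]
  exact ae_of_all _ fun k => ENNReal.natCast_ne_top k

lemma ae_count_eq_zero (hN : IsPoissonPointProcess N ν P) (hB : MeasurableSet B)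
    (hB' : ν B = 0) : ∀ᵐ ω ∂P, N ω B = 0 := by
  have hm : MeasurableSet {a : ℝ≥0∞ | a = 0} := measurableSet_singleton 0
  rw [(hN.hasLaw_count B hB (by simp [hB'])).ae_iff (p := fun a => a = 0)
    (measurableSet_setOfPred.1 hm), ae_map_iff (by fun_prop) hm, hB', ae_iff]
  refine measure_mono_null (fun k hk => ?_) ((poissonMeasure_Ici 0 1).trans (by simp))
  simpa [Nat.one_le_iff_ne_zero] using hk

lemma ae_count_eq_top [IsFiniteMeasure P] [SigmaFinite ν] (hN : IsPoissonPointProcess N ν P)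
    (hNm : Measurable N) (hB : MeasurableSet B) (hB' : ν B = ∞) : ∀ᵐ ω ∂P, N ω B = ∞ := by
  have hlt : 1 - expNeg 1 ≠ 0 := by
    have hne : expNeg 1 ≠ expNeg 0 := expNeg_injective.ne one_ne_zero
    rw [expNeg_zero] at hne
    exact (tsub_pos_of_lt ((expNeg_le_one 1).lt_of_ne hne)).ne'
  have hind (y : E) : 1 - expNeg (B.indicator 1 y) = B.indicator (fun _ => 1 - expNeg 1) y := by
    by_cases hy : y ∈ B <;> simp [hy]
  have hzero := hN.laplaceFunctional_eq hNm (measurable_one.indicator hB)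
  simp_rw [laplaceFunctional, lintegral_indicator_one hB, hind, lintegral_indicator_const hB, hB',
    ENNReal.mul_top hlt, expNeg_top] at hzero
  have hm : Measurable fun ω => expNeg (N ω B) :=
    measurable_expNeg.comp ((Measure.measurable_coe hB).comp hNm)
  filter_upwards [(lintegral_eq_zero_iff hm).1 hzero] with ω hω
  exact expNeg_injective (hω.trans expNeg_top.symm)

lemma measure_two_le_count (hN : IsPoissonPointProcess N ν P) (hB : MeasurableSet B) :
    P {ω | 2 ≤ N ω B} ≤ ν B ^ 2 := by
  by_cases hB' : ν B = ∞
  · simp [hB']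
  have htail := hN.measure_le_count hB hB' 2
  rw [Nat.cast_ofNat] at htail
  rw [htail, ← ENNReal.ofReal_toReal hB', ← ENNReal.ofReal_pow ENNReal.toReal_nonneg,
    ENNReal.toReal_ofReal ENNReal.toReal_nonneg]
  refine ENNReal.ofReal_le_ofReal ?_
  set r := (ν B).toReal
  have : 0 ≤ 1 + r := add_nonneg zero_le_one ENNReal.toReal_nonneg
  calc 1 - ∑ k ∈ Finset.range 2, Real.exp (-r) * r ^ k / k.factorial
      = 1 - Real.exp (-r) * (1 + r) := by simp [Finset.sum_range_succ]; ring
    _ ≤ 1 - (1 - r) * (1 + r) := by gcongr; exact Real.one_sub_le_exp_neg r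
    _ = r ^ 2 := by ring

-- A double point in `B` is a double point of one of the cells into which `f` divides `B`.
lemma measure_exists_two_le_count_singleton_le [SFinite ν] (hN : IsPoissonPointProcess N ν P)
    (hB : MeasurableSet B) {γ : Type*} [Finite γ] [MeasurableSpace γ] [MeasurableSingletonClass γ]
    {f : E → γ} (hf : Measurable f) :
    P {ω | ∃ z ∈ B, 2 ≤ N ω {z}} ≤ (ν.prod ν) ((B ×ˢ B) ∩ {p | f p.1 = f p.2}) := by
  have := Fintype.ofFinite γ
  let C : γ → Set E := fun c => B ∩ f ⁻¹' {c}
  have hC : ∀ c, MeasurableSet (C c) := fun c => hB.inter (hf (measurableSet_singleton c))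
  have hdisj : Pairwise (Function.onFun Disjoint fun c => C c ×ˢ C c) := fun c d hcd =>
    Set.disjoint_left.2 fun p hc hd => hcd (hc.1.2.symm.trans hd.1.2)
  calc P {ω | ∃ z ∈ B, 2 ≤ N ω {z}}
      ≤ P (⋃ c, {ω | 2 ≤ N ω (C c)}) := measure_mono fun ω ⟨z, hz, hω⟩ =>
        Set.mem_iUnion.2 ⟨f z, hω.trans (measure_mono (Set.singleton_subset_iff.2 ⟨hz, rfl⟩))⟩
    _ ≤ ∑ c, P {ω | 2 ≤ N ω (C c)} := measure_iUnion_fintype_le _ _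
    _ ≤ ∑ c, ν (C c) ^ 2 := Finset.sum_le_sum fun c _ => hN.measure_two_le_count (hC c)
    _ = (ν.prod ν) (⋃ c, C c ×ˢ C c) := by
        rw [measure_iUnion hdisj fun c => (hC c).prod (hC c), tsum_fintype]
        simp_rw [Measure.prod_prod, sq]
    _ ≤ (ν.prod ν) ((B ×ˢ B) ∩ {p | f p.1 = f p.2}) := measure_mono <|
        Set.iUnion_subset fun c p hp => ⟨⟨hp.1.1, hp.2.1⟩, hp.1.2.trans hp.2.2.symm⟩

lemma ae_forall_mem_count_singleton_lt_two [SFinite ν] [NullSingletonClass ν]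
    [MeasurableSpace.CountablySeparated E] (hN : IsPoissonPointProcess N ν P)
    (hB : MeasurableSet B) (hB' : ν B ≠ ∞) : ∀ᵐ ω ∂P, ∀ z ∈ B, N ω {z} < 2 := by
  obtain ⟨e, he, he_inj⟩ := MeasurableSpace.measurable_injection_nat_bool_of_countablySeparated E
  let f : (n : ℕ) → E → Fin n → Bool := fun n y i => e y i
  have hf : ∀ n, Measurable (f n) := fun n => by fun_prop
  let A : ℕ → Set (E × E) := fun n => (B ×ˢ B) ∩ {p | f n p.1 = f n p.2}
  have hA : ∀ n, MeasurableSet (A n) := fun n => (hB.prod hB).inter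
    (measurableSet_eq_fun ((hf n).comp measurable_fst) ((hf n).comp measurable_snd))
  have hanti : Antitone A := fun m n hmn p hp =>
    ⟨hp.1, funext fun i => congrFun hp.2 (Fin.castLE hmn i)⟩
  have hdiag : (ν.prod ν) (⋂ n, A n) = 0 := by
    rw [Measure.measure_prod_null (.iInter hA)]
    refine ae_of_all _ fun y => measure_mono_null (fun z hz => ?_) (measure_singleton y)
    exact he_inj (funext fun i =>
      (congrFun (Set.mem_iInter.1 hz (i + 1)).2 (Fin.last i)).symm)
  have hlim : Filter.Tendsto (fun n => (ν.prod ν) (A n)) Filter.atTop (nhds 0) := by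
    rw [← hdiag]
    refine tendsto_measure_iInter_atTop (fun n => (hA n).nullMeasurableSet) hanti ⟨0, ?_⟩
    refine ne_top_of_le_ne_top ?_ (measure_mono Set.inter_subset_left)
    rw [Measure.prod_prod]
    exact ENNReal.mul_ne_top hB' hB'
  have hzero := ge_of_tendsto' hlim fun n => hN.measure_exists_two_le_count_singleton_le hB (hf n)
  simpa [ae_iff] using le_antisymm hzero zero_le

theorem ae_count_singleton_lt_two [SigmaFinite ν] [NullSingletonClass ν]
    [MeasurableSpace.CountablySeparated E] (hN : IsPoissonPointProcess N ν P) :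
    ∀ᵐ ω ∂P, ∀ z, N ω {z} < 2 := by
  filter_upwards [ae_all_iff.2 fun n => hN.ae_forall_mem_count_singleton_lt_two
    (measurableSet_spanningSets ν n) (measure_spanningSets_lt_top ν n).ne] with ω hω z
  exact hω _ z (mem_spanningSetsIndex ν z)

end IsPoissonPointProcess

section NthLargest

variable {ι : Type*} {S : Set ι} {a : ι → ℝ}

/-- The rank of the member `i` in the decreasing order of the family `a` over `S`, starting from
`1`; it is meaningful when only finitely many members are at least `a i`. -/
noncomputable def rankIn (S : Set ι) (a : ι → ℝ) (i : ι) : ℕ := {j | j ∈ S ∧ a i ≤ a j}.ncard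

lemma rankIn_le_encard_iff (hfin : ∀ i ∈ S, {j | j ∈ S ∧ a i ≤ a j}.Finite) {i : ι} (hi : i ∈ S)
    (t : ℝ) : (rankIn S a i : ℕ∞) ≤ {j | j ∈ S ∧ t ≤ a j}.encard ↔ t ≤ a i := by
  rw [rankIn, (hfin i hi).cast_ncard_eq]
  refine ⟨fun h => ?_, fun h => Set.encard_le_encard fun j hj => ⟨hj.1, h.trans hj.2⟩⟩
  by_contra! hlt
  have hss : {j | j ∈ S ∧ t ≤ a j} ⊂ {j | j ∈ S ∧ a i ≤ a j} :=
    ⟨fun j hj => ⟨hj.1, hlt.le.trans hj.2⟩, fun hsub => hlt.not_ge (hsub ⟨hi, le_rfl⟩).2⟩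
  exact h.not_gt (((hfin i hi).subset hss.subset).encard_lt_encard hss)

lemma rankIn_le_rankIn_iff (hfin : ∀ i ∈ S, {j | j ∈ S ∧ a i ≤ a j}.Finite) {i j : ι}
    (hi : i ∈ S) (hj : j ∈ S) : rankIn S a i ≤ rankIn S a j ↔ a j ≤ a i := by
  rw [← rankIn_le_encard_iff hfin hi, ← (hfin j hj).cast_ncard_eq, Nat.cast_le, rankIn, rankIn]

lemma injOn_rankIn (hfin : ∀ i ∈ S, {j | j ∈ S ∧ a i ≤ a j}.Finite) (hinj : Set.InjOn a S) :
    Set.InjOn (rankIn S a) S := fun _ hi _ hj hij =>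
  hinj hi hj (le_antisymm ((rankIn_le_rankIn_iff hfin hj hi).1 hij.ge)
    ((rankIn_le_rankIn_iff hfin hi hj).1 hij.le))

lemma one_le_rankIn (hfin : ∀ i ∈ S, {j | j ∈ S ∧ a i ≤ a j}.Finite) {i : ι} (hi : i ∈ S) :
    1 ≤ rankIn S a i :=
  (Set.ncard_pos (hfin i hi)).2 ⟨i, hi, le_rfl⟩

lemma exists_rankIn_eq (hfin : ∀ i ∈ S, {j | j ∈ S ∧ a i ≤ a j}.Finite) (hinj : Set.InjOn a S)
    (hinf : S.Infinite) {n : ℕ} (hn : 1 ≤ n) : ∃ i ∈ S, rankIn S a i = n := by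
  obtain ⟨_, ⟨i, hi, rfl⟩, hni⟩ := (hinf.image (injOn_rankIn hfin hinj)).exists_gt n
  -- the members ranked up to `i` have distinct ranks in `{1, …, rankIn S a i}`, so take all of them
  let F := (hfin i hi).toFinset
  have hF {j : ι} (hj : j ∈ F) : j ∈ S ∧ a i ≤ a j := by simpa [F] using hj
  have hmaps : Set.MapsTo (rankIn S a) F (Finset.Icc 1 (rankIn S a i)) := fun j hj =>
    Finset.mem_coe.2 (Finset.mem_Icc.2 ⟨one_le_rankIn hfin (hF hj).1,
      (rankIn_le_rankIn_iff hfin (hF hj).1 hi).2 (hF hj).2⟩)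
  have hcard : (Finset.Icc 1 (rankIn S a i)).card ≤ F.card := by
    simp [F, rankIn, Set.ncard_eq_toFinset_card _ (hfin i hi)]
  obtain ⟨j, hj, hjn⟩ := Finset.surjOn_of_injOn_of_card_le (rankIn S a) hmaps
    ((injOn_rankIn hfin hinj).mono fun j hj => (hF hj).1) hcard
    (Finset.mem_coe.2 (Finset.mem_Icc.2 ⟨hn, hni.le⟩))
  exact ⟨j, (hF hj).1, hjn⟩

lemma nthLargest_rankIn (hfin : ∀ i ∈ S, {j | j ∈ S ∧ a i ≤ a j}.Finite) {i : ι} (hi : i ∈ S) :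
    nthLargest S a (rankIn S a i) = a i := by
  simp_rw [nthLargest, rankIn_le_encard_iff hfin hi]
  exact csSup_Iic

lemma strictAntiOn_nthLargest (hfin : ∀ i ∈ S, {j | j ∈ S ∧ a i ≤ a j}.Finite)
    (hinj : Set.InjOn a S) (hinf : S.Infinite) : StrictAntiOn (nthLargest S a) (Set.Ici 1) := by
  intro m hm n hn hmn
  obtain ⟨i, hi, rfl⟩ := exists_rankIn_eq hfin hinj hinf hm
  obtain ⟨j, hj, rfl⟩ := exists_rankIn_eq hfin hinj hinf hn
  rw [nthLargest_rankIn hfin hi, nthLargest_rankIn hfin hj]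
  exact lt_of_not_ge fun h => hmn.not_ge ((rankIn_le_rankIn_iff hfin hj hi).2 h)

lemma image_nthLargest (hfin : ∀ i ∈ S, {j | j ∈ S ∧ a i ≤ a j}.Finite)
    (hinj : Set.InjOn a S) (hinf : S.Infinite) : nthLargest S a '' Set.Ici 1 = a '' S := by
  ext t
  constructor
  · rintro ⟨n, hn, rfl⟩
    obtain ⟨i, hi, rfl⟩ := exists_rankIn_eq hfin hinj hinf hn
    exact ⟨i, hi, (nthLargest_rankIn hfin hi).symm⟩
  · rintro ⟨i, hi, rfl⟩
    exact ⟨_, one_le_rankIn hfin hi, nthLargest_rankIn hfin hi⟩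

lemma le_nthLargest_iff (hfin : ∀ i ∈ S, {j | j ∈ S ∧ a i ≤ a j}.Finite)
    (hinj : Set.InjOn a S) (hinf : S.Infinite) {n : ℕ} (hn : 1 ≤ n) (t : ℝ) :
    t ≤ nthLargest S a n ↔ (n : ℕ∞) ≤ {i | i ∈ S ∧ t ≤ a i}.encard := by
  obtain ⟨i, hi, rfl⟩ := exists_rankIn_eq hfin hinj hinf hn
  rw [nthLargest_rankIn hfin hi, rankIn_le_encard_iff hfin hi]

end NthLargest

lemma lintegral_Ioc_ofReal_deriv {G g : ℝ → ℝ} {a b : ℝ} (hab : a ≤ b)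
    (hc : ContinuousOn G (Set.Icc a b)) (hd : ∀ t ∈ Set.Ioo a b, HasDerivAt G (g t) t)
    (hg : ∀ t ∈ Set.Ioo a b, 0 ≤ g t) :
    ∫⁻ t in Set.Ioc a b, ENNReal.ofReal (g t) = ENNReal.ofReal (G b - G a) := by
  have hint : IntegrableOn g (Set.Ioc a b) := intervalIntegral.integrableOn_deriv_of_nonneg hc hd hg
  have hg' : 0 ≤ᵐ[volume.restrict (Set.Ioc a b)] g := by
    rw [← restrict_Ioo_eq_restrict_Ioc]
    exact (ae_restrict_iff' measurableSet_Ioo).2 (ae_of_all _ hg)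
  rw [← ofReal_integral_eq_lintegral_ofReal hint hg', ← intervalIntegral.integral_of_le hab,
    intervalIntegral.integral_eq_sub_of_hasDerivAt_of_le hab hc hd
      ((intervalIntegrable_iff_integrableOn_Ioc_of_le hab).2 hint)]

section Sector

variable {p : ℝ} (hp : 0 < p)

lemma measurable_toIcoMod (a : ℝ) : Measurable (toIcoMod hp a) := by
  rw [funext (toIcoMod_eq_add_fract_mul hp a)]
  fun_prop

lemma volume_setOf_toIcoMod_le_inter_Ioc {a c : ℝ} (hcp : c ≤ a + p) (b : ℝ) :
    volume ({θ | toIcoMod hp a θ ≤ c} ∩ Set.Ioc b (b + p)) = ENNReal.ofReal (c - a) := by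
  have hinv (g : AddSubgroup.zmultiples p) :
      (fun θ : ℝ => g +ᵥ θ) ⁻¹' {θ | toIcoMod hp a θ ≤ c} = {θ | toIcoMod hp a θ ≤ c} := by
    obtain ⟨_, n, rfl⟩ := g
    ext θ
    simp [AddSubgroup.vadd_def]
  have hIco : {θ | toIcoMod hp a θ ≤ c} ∩ Set.Ico a (a + p) = Set.Iic c ∩ Set.Ico a (a + p) := by
    ext θ
    refine and_congr_left fun hθ => ?_
    rw [Set.mem_ofPred_eq, (toIcoMod_eq_self hp).2 hθ, Set.mem_Iic]
  calc
    _ = volume ({θ | toIcoMod hp a θ ≤ c} ∩ Set.Ioc a (a + p)) :=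
      (isAddFundamentalDomain_Ioc hp b).measure_set_eq (isAddFundamentalDomain_Ioc hp a)
        (measurableSet_le (measurable_toIcoMod hp a) measurable_const) hinv
    _ = volume (Set.Iic c ∩ Set.Ico a (a + p)) :=
      (measure_congr ((ae_eq_refl _).inter Ico_ae_eq_Ioc.symm)).trans (congrArg volume hIco)
    _ = volume (Set.Iic c ∩ Set.Ioc a (a + p)) :=
      measure_congr ((ae_eq_refl _).inter Ico_ae_eq_Ioc)
    _ = ENNReal.ofReal (c - a) := by
      rw [Set.inter_comm, Set.Ioc_inter_Iic, min_eq_right hcp, Real.volume_Ioc]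

lemma volume_setOf_arg_mem_norm_le {A : Set ℝ} (hA : MeasurableSet A) {R : ℝ} (hR : 0 ≤ R) :
    volume {c : ℂ | c.arg ∈ A ∧ ‖c‖ ≤ R} =
      ENNReal.ofReal (R ^ 2 / 2) * volume (A ∩ Set.Ioo (-Real.pi) Real.pi) := by
  have hC : MeasurableSet {c : ℂ | c.arg ∈ A ∧ ‖c‖ ≤ R} :=
    (Complex.measurable_arg hA).inter (measurableSet_le measurable_norm measurable_const)
  have hpolar : Set.EqOn
      (fun p => ENNReal.ofReal p.1 •
        {c : ℂ | c.arg ∈ A ∧ ‖c‖ ≤ R}.indicator 1 (Complex.polarCoord.symm p))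
      (fun p => (Set.Iic R).indicator ENNReal.ofReal p.1 * A.indicator 1 p.2)
      polarCoord.target := by
    rintro ⟨r, θ⟩ hrθ
    rw [polarCoord_target] at hrθ
    obtain ⟨hr, hθ⟩ := hrθ
    have harg : (Complex.polarCoord.symm (r, θ)).arg = θ := by
      rw [Complex.polarCoord_symm_apply, Complex.ofReal_cos, Complex.ofReal_sin]
      exact Complex.arg_mul_cos_add_sin_mul_I hr ⟨hθ.1, hθ.2.le⟩
    have hnorm : ‖Complex.polarCoord.symm (r, θ)‖ = r := by
      rw [Complex.norm_polarCoord_symm, abs_of_pos hr]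
    by_cases h1 : r ≤ R <;> by_cases h2 : θ ∈ A <;>
      simp [Set.indicator, harg, hnorm, h1, h2, -Complex.polarCoord_symm_apply]
  have hradius : ∫⁻ r in Set.Ioc 0 R, ENNReal.ofReal r = ENNReal.ofReal (R ^ 2 / 2) := by
    rw [lintegral_Ioc_ofReal_deriv (G := fun r => r ^ 2 / 2) hR (by fun_prop)
      (fun t _ => by simpa using (hasDerivAt_pow 2 t).div_const 2) fun t ht => ht.1.le]
    simp
  rw [← lintegral_indicator_one hC, ← Complex.lintegral_comp_polarCoord_symm,
    setLIntegral_congr_fun polarCoord.open_target.measurableSet hpolar, polarCoord_target,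
    Measure.volume_eq_prod, ← Measure.prod_restrict,
    lintegral_prod_mul (ENNReal.measurable_ofReal.indicator measurableSet_Iic).aemeasurable
      (measurable_one.indicator hA).aemeasurable,
    lintegral_indicator_one hA, Measure.restrict_apply hA, lintegral_indicator measurableSet_Iic,
    Measure.restrict_restrict measurableSet_Iic, Set.inter_comm, Set.Ioi_inter_Iic, hradius]

lemma directionAngle_eq_toIcoMod_arg (v : EuclideanSpace ℝ (Fin 2)) :
    directionAngle v =
      toIcoMod Real.two_pi_pos 0 (Complex.orthonormalBasisOneI.repr.symm v).arg := by
  rw [directionAngle, Complex.orthonormalBasisOneI_repr_symm_apply, Complex.mk_eq_add_mul_I]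

lemma measurable_directionAngle : Measurable directionAngle := by
  rw [funext directionAngle_eq_toIcoMod_arg]
  exact (measurable_toIcoMod _ 0).comp (Complex.measurable_arg.comp (by fun_prop))

lemma volume_sector (x : EuclideanSpace ℝ (Fin 2)) {φ R : ℝ} (hφ' : φ ≤ 2 * Real.pi)
    (hR : 0 ≤ R) :
    volume {y | directionAngle (y - x) ≤ φ ∧ ‖y - x‖ ≤ R} = ENNReal.ofReal (φ / 2 * R ^ 2) := by
  have hA : MeasurableSet {θ | toIcoMod Real.two_pi_pos 0 θ ≤ φ} :=
    measurableSet_le (measurable_toIcoMod _ 0) measurable_const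
  have hC : MeasurableSet {c : ℂ | c.arg ∈ {θ | toIcoMod Real.two_pi_pos 0 θ ≤ φ} ∧ ‖c‖ ≤ R} :=
    (Complex.measurable_arg hA).inter (measurableSet_le measurable_norm measurable_const)
  have hangles : volume ({θ | toIcoMod Real.two_pi_pos 0 θ ≤ φ} ∩ Set.Ioo (-Real.pi) Real.pi) =
      ENNReal.ofReal φ := by
    rw [measure_congr ((ae_eq_refl _).inter Ioo_ae_eq_Ioc)]
    have h := volume_setOf_toIcoMod_le_inter_Ioc Real.two_pi_pos (a := 0) (by simpa using hφ')
      (-Real.pi)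
    rwa [show -Real.pi + 2 * Real.pi = Real.pi by ring, sub_zero] at h
  have hplane : MeasurePreserving fun y => Complex.orthonormalBasisOneI.repr.symm (y - x) :=
    (LinearIsometryEquiv.measurePreserving _).comp (measurePreserving_sub_right volume x)
  have h := hplane.measure_preimage hC.nullMeasurableSet
  rw [volume_setOf_arg_mem_norm_le hA hR, hangles, ← ENNReal.ofReal_mul (by positivity)] at h
  simp only [directionAngle_eq_toIcoMod_arg]
  convert! h using 2
  · ext y
    simp only [Set.mem_ofPred_eq, Set.mem_preimage, LinearIsometryEquiv.norm_map]
  · ring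

end Sector

section Intensity

variable {lam α φ m : ℝ}

lemma cumulativeIntensity_zero (hα : 0 < α) : cumulativeIntensity lam α φ m 0 = 0 := by
  rw [cumulativeIntensity, Real.zero_rpow (by positivity), mul_zero]

lemma continuous_cumulativeIntensity (hα : 0 < α) :
    Continuous (cumulativeIntensity lam α φ m) :=
  continuous_const.mul (Real.continuous_rpow_const (by positivity))

lemma hasDerivAt_cumulativeIntensity {t : ℝ} (ht : 0 < t) :
    HasDerivAt (cumulativeIntensity lam α φ m) (φ * lam / α * m * t ^ (2 / α - 1)) t := by
  have h := (Real.hasDerivAt_rpow_const (p := 2 / α) (Or.inl ht.ne')).const_mul (φ * lam / 2 * m)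
  convert! h using 1
  ring

lemma cumulativeIntensity_nonneg (hlam : 0 ≤ lam) (hφ : 0 ≤ φ) (hm : 0 ≤ m) {z : ℝ}
    (hz : 0 ≤ z) : 0 ≤ cumulativeIntensity lam α φ m z := by
  unfold cumulativeIntensity
  positivity

lemma tendsto_cumulativeIntensity_atTop (hlam : 0 < lam) (hα : 0 < α) (hφ : 0 < φ) (hm : 0 < m) :
    Filter.Tendsto (cumulativeIntensity lam α φ m) Filter.atTop Filter.atTop :=
  (tendsto_rpow_atTop (by positivity)).const_mul_atTop (by positivity)

lemma powerAxisIntensity_apply {A : Set ℝ} (hA : MeasurableSet A) :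
    powerAxisIntensity lam α φ m A =
      ∫⁻ z in A ∩ Set.Ioi 0, ENNReal.ofReal (φ * lam / α * m * z ^ (2 / α - 1)) := by
  rw [powerAxisIntensity, withDensity_apply _ hA, Measure.restrict_restrict hA]

lemma powerAxisIntensity_Iic (hlam : 0 ≤ lam) (hα : 0 < α) (hφ : 0 ≤ φ) (hm : 0 ≤ m) {z : ℝ}
    (hz : 0 ≤ z) : powerAxisIntensity lam α φ m (Set.Iic z) =
      ENNReal.ofReal (cumulativeIntensity lam α φ m z) := by
  have hdensity {t : ℝ} (ht : 0 < t) : 0 ≤ φ * lam / α * m * t ^ (2 / α - 1) := by positivity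
  rw [powerAxisIntensity_apply measurableSet_Iic, Set.inter_comm, Set.Ioi_inter_Iic,
    lintegral_Ioc_ofReal_deriv hz (continuous_cumulativeIntensity hα).continuousOn
      (fun t ht => hasDerivAt_cumulativeIntensity ht.1) (fun t ht => hdensity ht.1),
    cumulativeIntensity_zero hα, sub_zero]

lemma powerAxisIntensity_Iic_zero : powerAxisIntensity lam α φ m (Set.Iic 0) = 0 := by
  rw [powerAxisIntensity_apply measurableSet_Iic, Set.inter_comm, Set.Ioi_inter_Iic, Set.Ioc_self,
    setLIntegral_empty]

lemma powerAxisIntensity_Icc (hlam : 0 ≤ lam) (hα : 0 < α) (hφ : 0 ≤ φ) (hm : 0 ≤ m) {z : ℝ}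
    (hz : 0 ≤ z) : powerAxisIntensity lam α φ m (Set.Icc 0 z) =
      ENNReal.ofReal (cumulativeIntensity lam α φ m z) := by
  rw [← powerAxisIntensity_Iic hlam hα hφ hm hz, ← Set.Iic_sdiff_Iio,
    measure_sdiff_null (measure_mono_null Set.Iio_subset_Iic_self powerAxisIntensity_Iic_zero)]

lemma powerAxisIntensity_univ (hlam : 0 < lam) (hα : 0 < α) (hφ : 0 < φ) (hm : 0 < m) :
    powerAxisIntensity lam α φ m Set.univ = ∞ := by
  have htop : Filter.Tendsto (fun z => ENNReal.ofReal (cumulativeIntensity lam α φ m z))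
      Filter.atTop (nhds ∞) :=
    ENNReal.tendsto_ofReal_nhds_top.2 (tendsto_cumulativeIntensity_atTop hlam hα hφ hm)
  refine top_unique (le_of_tendsto htop ?_)
  filter_upwards [Filter.eventually_ge_atTop 0] with z hz
  rw [← powerAxisIntensity_Iic hlam.le hα hφ.le hm.le hz]
  exact measure_mono (Set.subset_univ _)

instance : SigmaFinite (powerAxisIntensity lam α φ m) :=
  SigmaFinite.withDensity_ofReal _

instance : NullSingletonClass (powerAxisIntensity lam α φ m) :=
  nullSingletonClass_withDensity _

lemma measure_ext_of_forall_Iic {μ ν : Measure ℝ} (hμ : ∀ z, μ (Set.Iic z) ≠ ∞)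
    (h : ∀ z, μ (Set.Iic z) = ν (Set.Iic z)) : μ = ν := by
  refine Measure.ext_of_Ioc' _ _ (fun a b _ => ?_) fun a b hab => ?_
  · exact ne_top_of_le_ne_top (hμ b) (measure_mono Set.Ioc_subset_Iic_self)
  · rw [← Set.Iic_sdiff_Iic, measure_sdiff (Set.Iic_subset_Iic.2 hab.le)
      measurableSet_Iic.nullMeasurableSet (hμ a), measure_sdiff (Set.Iic_subset_Iic.2 hab.le)
      measurableSet_Iic.nullMeasurableSet (h a ▸ hμ a), h, h]

lemma volume_sector_rpow_div_le (x : EuclideanSpace ℝ (Fin 2)) (hα : 0 < α)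
    (hφ' : φ ≤ 2 * Real.pi) {g z : ℝ} (hg : 0 < g) (hz : 0 ≤ z) :
    volume {y | directionAngle (y - x) ≤ φ ∧ ‖y - x‖ ^ α / g ≤ z} =
      ENNReal.ofReal (φ / 2 * z ^ (2 / α) * g ^ (2 / α)) := by
  have hball (y : EuclideanSpace ℝ (Fin 2)) : ‖y - x‖ ^ α / g ≤ z ↔ ‖y - x‖ ≤ (z * g) ^ α⁻¹ := by
    rw [div_le_iff₀ hg, Real.le_rpow_inv_iff_of_pos (norm_nonneg _) (by positivity) hα]
  have hradius : ((z * g) ^ α⁻¹) ^ 2 = z ^ (2 / α) * g ^ (2 / α) := by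
    rw [← Real.mul_rpow hz hg.le, ← Real.rpow_mul_natCast (by positivity), Nat.cast_ofNat,
      inv_mul_eq_div]
  simp_rw [hball]
  rw [volume_sector x hφ' (by positivity), hradius, mul_assoc]

section Pushforward

variable (x : EuclideanSpace ℝ (Fin 2)) {μ : Measure ℝ} [SFinite μ]

lemma measurableSet_sector : MeasurableSet
    {p : EuclideanSpace ℝ (Fin 2) × ℝ | directionAngle (p.1 - x) ≤ φ} :=
  measurableSet_le (measurable_directionAngle.comp (by fun_prop)) measurable_const

lemma map_restrict_sector_Iic (hlam : 0 ≤ lam) (hα : 0 < α) (hφ : 0 ≤ φ) (hφ' : φ ≤ 2 * Real.pi)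
    (hpos : ∀ᵐ g ∂μ, 0 < g) (hint : Integrable (fun g => g ^ (2 / α)) μ) {z : ℝ} (hz : 0 ≤ z) :
    (((ENNReal.ofReal lam • volume).prod μ).restrict
        {p : EuclideanSpace ℝ (Fin 2) × ℝ | directionAngle (p.1 - x) ≤ φ}).map
      (fun p => ‖p.1 - x‖ ^ α / p.2) (Set.Iic z) =
    ENNReal.ofReal (cumulativeIntensity lam α φ (∫ g, g ^ (2 / α) ∂μ) z) := by
  have hT : Measurable fun p : EuclideanSpace ℝ (Fin 2) × ℝ => ‖p.1 - x‖ ^ α / p.2 := by fun_prop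
  have hslice : ∀ᵐ g ∂μ, (ENNReal.ofReal lam • volume)
      {y | ‖y - x‖ ^ α / g ≤ z ∧ directionAngle (y - x) ≤ φ} =
      ENNReal.ofReal (φ * lam / 2 * z ^ (2 / α) * g ^ (2 / α)) := by
    filter_upwards [hpos] with g hg
    simp_rw [and_comm (a := ‖_‖ ^ α / g ≤ z)]
    rw [Measure.smul_apply, smul_eq_mul, volume_sector_rpow_div_le x hα hφ' hg hz,
      ← ENNReal.ofReal_mul hlam]
    congr 1
    ring
  rw [Measure.map_apply hT measurableSet_Iic, Measure.restrict_apply (hT measurableSet_Iic),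
    Measure.prod_apply_symm ((hT measurableSet_Iic).inter (measurableSet_sector x))]
  refine (lintegral_congr_ae hslice).trans ?_
  rw [← ofReal_integral_eq_lintegral_ofReal (hint.const_mul _)
      (hpos.mono fun g hg => by positivity), integral_const_mul, cumulativeIntensity]
  congr 1
  ring

lemma map_restrict_sector (hlam : 0 ≤ lam) (hα : 0 < α) (hφ : 0 ≤ φ) (hφ' : φ ≤ 2 * Real.pi)
    (hpos : ∀ᵐ g ∂μ, 0 < g) (hint : Integrable (fun g => g ^ (2 / α)) μ) :
    (((ENNReal.ofReal lam • volume).prod μ).restrict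
        {p : EuclideanSpace ℝ (Fin 2) × ℝ | directionAngle (p.1 - x) ≤ φ}).map
      (fun p => ‖p.1 - x‖ ^ α / p.2) =
    powerAxisIntensity lam α φ (∫ g, g ^ (2 / α) ∂μ) := by
  have hm : 0 ≤ ∫ g, g ^ (2 / α) ∂μ :=
    integral_nonneg_of_ae (hpos.mono fun g hg => (Real.rpow_pos_of_pos hg _).le)
  have hIic {z : ℝ} (hz : 0 ≤ z) :=
    map_restrict_sector_Iic (lam := lam) x hlam hα hφ hφ' hpos hint hz
  refine measure_ext_of_forall_Iic (fun z => ?_) fun z => ?_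
  · exact ne_top_of_le_ne_top (hIic (le_max_right z 0) ▸ ENNReal.ofReal_ne_top)
      (measure_mono (Set.Iic_subset_Iic.2 (le_max_left z 0)))
  rcases le_or_gt 0 z with hz | hz
  · rw [hIic hz, powerAxisIntensity_Iic hlam hα hφ hm hz]
  · have hzero := hIic le_rfl
    rw [cumulativeIntensity_zero hα, ENNReal.ofReal_zero] at hzero
    rw [measure_mono_null (Set.Iic_subset_Iic.2 hz.le) hzero,
      measure_mono_null (Set.Iic_subset_Iic.2 hz.le) powerAxisIntensity_Iic_zero]

end Pushforward

end Intensity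

section Density

lemma hasDerivAt_sum_exp_neg_mul_pow_div_factorial (n : ℕ) (s : ℝ) :
    HasDerivAt (fun s : ℝ => ∑ k ∈ Finset.range (n + 1), Real.exp (-s) * s ^ k / k.factorial)
      (-(Real.exp (-s) * s ^ n / n.factorial)) s := by
  have hexp : HasDerivAt (fun s : ℝ => Real.exp (-s)) (-Real.exp (-s)) s := by
    simpa using (hasDerivAt_neg s).exp
  induction n with
  | zero => simpa using hexp
  | succ n ih =>
    simp_rw [Finset.sum_range_succ _ (n + 1)]
    refine (ih.add ((hexp.mul (hasDerivAt_pow (n + 1) s)).div_const _)).congr_deriv ?_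
    rw [Nat.factorial_succ]
    push_cast
    field_simp
    ring

variable {lam α φ m : ℝ}

lemma inverseDominantPDF_of_pos {z : ℝ} (hz : 0 < z) (n : ℕ) :
    inverseDominantPDF lam α φ m (n + 1) z =
      Real.exp (-cumulativeIntensity lam α φ m z) * cumulativeIntensity lam α φ m z ^ n /
        n.factorial * (φ * lam / α * m * z ^ (2 / α - 1)) := by
  have hderiv : φ * lam / α * m * z ^ (2 / α - 1) =
      2 * cumulativeIntensity lam α φ m z / (α * z) := by
    rw [cumulativeIntensity, Real.rpow_sub_one hz.ne']
    field_simp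
  rw [inverseDominantPDF, if_pos hz, pow_succ, Nat.add_sub_cancel, hderiv]
  field_simp

lemma withDensity_inverseDominantPDF_Iic (n : ℕ) (z : ℝ) :
    volume.withDensity (fun z => ENNReal.ofReal (inverseDominantPDF lam α φ m n z)) (Set.Iic z) =
      ∫⁻ t in Set.Ioc 0 z, ENNReal.ofReal (inverseDominantPDF lam α φ m n t) := by
  have hsupp : (Set.Ioi 0).indicator
      (fun t => ENNReal.ofReal (inverseDominantPDF lam α φ m n t)) =
      fun t => ENNReal.ofReal (inverseDominantPDF lam α φ m n t) :=
    Set.indicator_eq_self.2 fun t ht => by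
      by_contra h
      exact ht ((congrArg ENNReal.ofReal (if_neg h)).trans ENNReal.ofReal_zero)
  rw [withDensity_apply _ measurableSet_Iic, ← hsupp, lintegral_indicator measurableSet_Ioi,
    Measure.restrict_restrict measurableSet_Ioi, Set.Ioi_inter_Iic, hsupp]

lemma setLIntegral_inverseDominantPDF (hlam : 0 ≤ lam) (hα : 0 < α) (hφ : 0 ≤ φ) (hm : 0 ≤ m)
    (n : ℕ) {z : ℝ} (hz : 0 ≤ z) :
    ∫⁻ t in Set.Ioc 0 z, ENNReal.ofReal (inverseDominantPDF lam α φ m (n + 1) t) =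
      ENNReal.ofReal (1 - ∑ k ∈ Finset.range (n + 1),
        Real.exp (-cumulativeIntensity lam α φ m z) * cumulativeIntensity lam α φ m z ^ k /
          k.factorial) := by
  let tail (z : ℝ) : ℝ := 1 - ∑ k ∈ Finset.range (n + 1),
    Real.exp (-cumulativeIntensity lam α φ m z) * cumulativeIntensity lam α φ m z ^ k / k.factorial
  have hcont : Continuous tail := by
    have := continuous_cumulativeIntensity (lam := lam) (φ := φ) (m := m) hα
    fun_prop
  have hderiv {t : ℝ} (ht : 0 < t) :
      HasDerivAt tail (inverseDominantPDF lam α φ m (n + 1) t) t := by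
    have h := ((hasDerivAt_sum_exp_neg_mul_pow_div_factorial n _).comp t
      (hasDerivAt_cumulativeIntensity (lam := lam) (α := α) (φ := φ) (m := m) ht)).const_sub 1
    rwa [neg_mul, neg_neg, ← inverseDominantPDF_of_pos ht] at h
  have hnonneg {t : ℝ} (ht : 0 < t) : 0 ≤ inverseDominantPDF lam α φ m (n + 1) t := by
    have := cumulativeIntensity_nonneg (α := α) hlam hφ hm ht.le
    rw [inverseDominantPDF_of_pos ht]
    positivity
  have htail : tail 0 = 0 := by
    simp [tail, cumulativeIntensity_zero hα, Finset.sum_range_succ']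
  rw [lintegral_Ioc_ofReal_deriv hz hcont.continuousOn (fun t ht => hderiv ht.1)
    (fun t ht => hnonneg ht.1), htail, sub_zero]

lemma hasLaw_of_forall_Iic {Ω : Type*} [MeasurableSpace Ω] {P : Measure Ω} [IsFiniteMeasure P]
    {Z : Ω → ℝ} {ν : Measure ℝ} (hZ : ∀ z, NullMeasurableSet {ω | Z ω ≤ z} P)
    (hν : ∀ z, P {ω | Z ω ≤ z} = ν (Set.Iic z)) : HasLaw Z ν P := by
  have hZm : AEMeasurable Z P :=
    NullMeasurable.aemeasurable (measurable_of_Iic (δ := NullMeasurableSpace Ω P) hZ)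
  refine ⟨hZm, Measure.ext_of_Iic _ _ fun z => ?_⟩
  rw [Measure.map_apply_of_aemeasurable hZm measurableSet_Iic, ← hν]
  rfl

end Density

/-- The interference powers of the interferers of the configuration `(X, h)` can be listed as a
strictly decreasing infinite sequence of positive numbers tending to zero. -/
structure IsRankable (α φ : ℝ) (x : EuclideanSpace ℝ (Fin 2))
    (X : ℕ → EuclideanSpace ℝ (Fin 2)) (h : ℕ → ℝ) : Prop where
  pos : ∀ i ∈ interferers φ x X, 0 < interferencePower α x (X i) (h i)
  finite : ∀ t, 0 < t → {i | i ∈ interferers φ x X ∧ t ≤ interferencePower α x (X i) (h i)}.Finite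
  injOn : Set.InjOn (fun i => interferencePower α x (X i) (h i)) (interferers φ x X)
  infinite : (interferers φ x X).Infinite

section PowerAxis

variable {α φ : ℝ} {x : EuclideanSpace ℝ (Fin 2)}

lemma interferencePower_eq_inv (y : EuclideanSpace ℝ (Fin 2)) (g : ℝ) :
    interferencePower α x y g = (‖y - x‖ ^ α / g)⁻¹ := by
  rw [interferencePower, Real.rpow_neg (norm_nonneg _), inv_div, norm_sub_rev, div_eq_mul_inv]

section Configuration

variable {X : ℕ → EuclideanSpace ℝ (Fin 2)} {h : ℕ → ℝ}

lemma powerAxisProcess_apply {B : Set ℝ} (hB : MeasurableSet B) :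
    powerAxisProcess α φ x X h B =
      {i | i ∈ interferers φ x X ∧ ‖X i - x‖ ^ α / h i ∈ B}.encard := by
  rw [powerAxisProcess, countingMeasure_apply _ hB, ← Subtype.val_injective.encard_image]
  congr 2
  ext i
  simp [and_comm]

lemma powerAxisProcess_eq_map_restrict :
    powerAxisProcess α φ x X h = ((countingMeasure fun i => (X i, h i)).restrict
        {p : EuclideanSpace ℝ (Fin 2) × ℝ | directionAngle (p.1 - x) ≤ φ}).map
      (fun p => ‖p.1 - x‖ ^ α / p.2) := by
  have hT : Measurable fun p : EuclideanSpace ℝ (Fin 2) × ℝ => ‖p.1 - x‖ ^ α / p.2 := by fun_prop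
  ext B hB
  rw [powerAxisProcess_apply hB, Measure.map_apply hT hB, Measure.restrict_apply (hT hB),
    countingMeasure_apply _ ((hT hB).inter (measurableSet_sector x))]
  congr 2
  ext i
  simp [interferers, and_comm]

namespace IsRankable

variable (hr : IsRankable α φ x X h)
include hr

lemma finite_setOf_le_interferencePower {i : ℕ} (hi : i ∈ interferers φ x X) :
    {j | j ∈ interferers φ x X ∧
      interferencePower α x (X i) (h i) ≤ interferencePower α x (X j) (h j)}.Finite :=
  hr.finite _ (hr.pos i hi)

lemma strictAntiOn_dominantPower : StrictAntiOn (dominantPower α φ x X h) (Set.Ici 1) :=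
  strictAntiOn_nthLargest (fun _ => hr.finite_setOf_le_interferencePower) hr.injOn hr.infinite

lemma image_dominantPower : dominantPower α φ x X h '' Set.Ici 1 =
    (fun i => interferencePower α x (X i) (h i)) '' interferers φ x X :=
  image_nthLargest (fun _ => hr.finite_setOf_le_interferencePower) hr.injOn hr.infinite

lemma inv_dominantPower_pos {n : ℕ} (hn : 1 ≤ n) : 0 < (dominantPower α φ x X h n)⁻¹ := by
  obtain ⟨i, hi, hin⟩ := hr.image_dominantPower.subset (Set.mem_image_of_mem _ hn)
  exact inv_pos.2 ((hr.pos i hi).trans_eq hin)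

lemma inv_dominantPower_le_iff {n : ℕ} (hn : 1 ≤ n) {z : ℝ} (hz : 0 < z) :
    (dominantPower α φ x X h n)⁻¹ ≤ z ↔ (n : ℝ≥0∞) ≤ powerAxisProcess α φ x X h (Set.Iic z) := by
  have hset : {i | i ∈ interferers φ x X ∧ z⁻¹ ≤ interferencePower α x (X i) (h i)} =
      {i | i ∈ interferers φ x X ∧ ‖X i - x‖ ^ α / h i ∈ Set.Iic z} := by
    ext i
    refine and_congr_right fun hi => ?_
    have hi' := hr.pos i hi
    rw [interferencePower_eq_inv] at hi' ⊢
    exact inv_le_inv₀ hz (inv_pos.1 hi')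
  rw [inv_le_comm₀ (inv_pos.1 (hr.inv_dominantPower_pos hn)) hz, dominantPower,
    le_nthLargest_iff (fun _ => hr.finite_setOf_le_interferencePower) hr.injOn hr.infinite hn, hset,
    powerAxisProcess_apply measurableSet_Iic, ← ENat.toENNReal_coe, ENat.toENNReal_le]

end IsRankable

end Configuration

variable {Ω : Type*} [MeasurableSpace Ω] {P : Measure Ω} {lam m : ℝ}
  {X : Ω → ℕ → EuclideanSpace ℝ (Fin 2)} {h : Ω → ℕ → ℝ}

lemma measurable_powerAxisProcess (hX : ∀ i, Measurable fun ω => X ω i)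
    (hh : ∀ i, Measurable fun ω => h ω i) :
    Measurable fun ω => powerAxisProcess α φ x (X ω) (h ω) := by
  have hT : Measurable fun p : EuclideanSpace ℝ (Fin 2) × ℝ => ‖p.1 - x‖ ^ α / p.2 := by fun_prop
  simp_rw [powerAxisProcess_eq_map_restrict]
  refine (Measure.measurable_map _ hT).comp (Measure.measurable_of_measurable_coe _ fun B hB => ?_)
  simp_rw [Measure.restrict_apply hB]
  exact (Measure.measurable_coe (hB.inter (measurableSet_sector x))).comp
    (measurable_countingMeasure fun i => (hX i).prodMk (hh i))

lemma ae_interferencePower_pos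
    (hN : IsPoissonPointProcess (fun ω => powerAxisProcess α φ x (X ω) (h ω))
      (powerAxisIntensity lam α φ m) P) :
    ∀ᵐ ω ∂P, ∀ i ∈ interferers φ x (X ω), 0 < interferencePower α x (X ω i) (h ω i) := by
  filter_upwards [hN.ae_count_eq_zero measurableSet_Iic powerAxisIntensity_Iic_zero] with ω hω i hi
  rw [powerAxisProcess_apply measurableSet_Iic, ENat.toENNReal_eq_zero, Set.encard_eq_zero] at hω
  rw [interferencePower_eq_inv, inv_pos]
  by_contra! hle
  exact Set.notMem_empty i (hω ▸ ⟨hi, hle⟩)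

lemma ae_finite_setOf_le_interferencePower (hlam : 0 ≤ lam) (hα : 0 < α) (hφ : 0 ≤ φ) (hm : 0 ≤ m)
    (hN : IsPoissonPointProcess (fun ω => powerAxisProcess α φ x (X ω) (h ω))
      (powerAxisIntensity lam α φ m) P) :
    ∀ᵐ ω ∂P, ∀ t, 0 < t →
      {i | i ∈ interferers φ x (X ω) ∧ t ≤ interferencePower α x (X ω i) (h ω i)}.Finite := by
  have hcount (k : ℕ) : ∀ᵐ ω ∂P, powerAxisProcess α φ x (X ω) (h ω) (Set.Iic (k : ℝ)) ≠ ∞ :=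
    hN.ae_count_ne_top measurableSet_Iic
      (powerAxisIntensity_Iic hlam hα hφ hm k.cast_nonneg ▸ ENNReal.ofReal_ne_top)
  filter_upwards [ae_all_iff.2 hcount] with ω hω t ht
  obtain ⟨k, hk⟩ := exists_nat_ge t⁻¹
  have hk' := hω k
  rw [powerAxisProcess_apply measurableSet_Iic, ENat.toENNReal_ne_top,
    Set.encard_ne_top_iff] at hk'
  refine hk'.subset fun i hi => ⟨hi.1, ?_⟩
  have hle := hi.2
  rw [interferencePower_eq_inv] at hle
  exact (le_inv_of_le_inv₀ ht hle).trans hk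

lemma ae_injOn_interferencePower
    (hN : IsPoissonPointProcess (fun ω => powerAxisProcess α φ x (X ω) (h ω))
      (powerAxisIntensity lam α φ m) P) :
    ∀ᵐ ω ∂P, Set.InjOn (fun i => interferencePower α x (X ω i) (h ω i))
      (interferers φ x (X ω)) := by
  filter_upwards [hN.ae_count_singleton_lt_two] with ω hω i hi j hj hij
  simp only [interferencePower_eq_inv, inv_inj] at hij
  have hi2 := hω (‖X ω i - x‖ ^ α / h ω i)
  rw [powerAxisProcess_apply (measurableSet_singleton _)] at hi2
  have hle : {k | k ∈ interferers φ x (X ω) ∧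
      ‖X ω k - x‖ ^ α / h ω k ∈ ({‖X ω i - x‖ ^ α / h ω i} : Set ℝ)}.encard ≤ 1 :=
    Order.le_of_lt_add_one (by exact_mod_cast hi2)
  exact Set.encard_le_one_iff.1 hle i j ⟨hi, rfl⟩ ⟨hj, hij.symm⟩

lemma ae_infinite_interferers [IsFiniteMeasure P] (hlam : 0 < lam) (hα : 0 < α) (hφ : 0 < φ)
    (hm : 0 < m) (hX : ∀ i, Measurable fun ω => X ω i) (hh : ∀ i, Measurable fun ω => h ω i)
    (hN : IsPoissonPointProcess (fun ω => powerAxisProcess α φ x (X ω) (h ω))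
      (powerAxisIntensity lam α φ m) P) :
    ∀ᵐ ω ∂P, (interferers φ x (X ω)).Infinite := by
  filter_upwards [hN.ae_count_eq_top (measurable_powerAxisProcess hX hh) MeasurableSet.univ
    (powerAxisIntensity_univ hlam hα hφ hm)] with ω hω
  rw [powerAxisProcess_apply MeasurableSet.univ] at hω
  simpa using hω

lemma ae_isRankable [IsFiniteMeasure P] (hlam : 0 < lam) (hα : 0 < α) (hφ : 0 < φ)
    (hm : 0 < m) (hX : ∀ i, Measurable fun ω => X ω i) (hh : ∀ i, Measurable fun ω => h ω i)
    (hN : IsPoissonPointProcess (fun ω => powerAxisProcess α φ x (X ω) (h ω))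
      (powerAxisIntensity lam α φ m) P) :
    ∀ᵐ ω ∂P, IsRankable α φ x (X ω) (h ω) := by
  filter_upwards [ae_interferencePower_pos hN,
    ae_finite_setOf_le_interferencePower hlam.le hα hφ.le hm.le hN, ae_injOn_interferencePower hN,
    ae_infinite_interferers hlam hα hφ hm hX hh hN] with ω hpos hfin hinj hinf
  exact ⟨hpos, hfin, hinj, hinf⟩

theorem hasLaw_inv_dominantPower [IsFiniteMeasure P] (hlam : 0 < lam) (hα : 0 < α) (hφ : 0 < φ)
    (hm : 0 < m) (hX : ∀ i, Measurable fun ω => X ω i) (hh : ∀ i, Measurable fun ω => h ω i)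
    (hN : IsPoissonPointProcess (fun ω => powerAxisProcess α φ x (X ω) (h ω))
      (powerAxisIntensity lam α φ m) P) {n : ℕ} (hn : 1 ≤ n) :
    HasLaw (fun ω => (dominantPower α φ x (X ω) (h ω) n)⁻¹)
      (volume.withDensity fun z => ENNReal.ofReal (inverseDominantPDF lam α φ m n z)) P := by
  have hrank := ae_isRankable hlam hα hφ hm hX hh hN
  have hnull {z : ℝ} (hz : z ≤ 0) : P {ω | (dominantPower α φ x (X ω) (h ω) n)⁻¹ ≤ z} = 0 :=
    measure_eq_zero_iff_ae_notMem.2 <|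
      hrank.mono fun _ hω => not_le.2 (hz.trans_lt (hω.inv_dominantPower_pos hn))
  have hcount {z : ℝ} (hz : 0 < z) : {ω | (dominantPower α φ x (X ω) (h ω) n)⁻¹ ≤ z} =ᵐ[P]
      {ω | (n : ℝ≥0∞) ≤ powerAxisProcess α φ x (X ω) (h ω) (Set.Iic z)} :=
    Filter.eventuallyEq_set.2 (hrank.mono fun _ hω => hω.inv_dominantPower_le_iff hn hz)
  have hΛ {z : ℝ} (hz : 0 < z) := powerAxisIntensity_Iic hlam.le hα hφ.le hm.le hz.le
  refine hasLaw_of_forall_Iic (fun z => ?_) fun z => ?_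
  · rcases le_or_gt z 0 with hz | hz
    · exact NullMeasurableSet.of_null (hnull hz)
    · have hmeas := measurable_powerAxisProcess (α := α) (φ := φ) (x := x) hX hh
      exact (measurableSet_le measurable_const
        ((Measure.measurable_coe measurableSet_Iic).comp hmeas)).nullMeasurableSet.congr
          (hcount hz).symm
  · rw [withDensity_inverseDominantPDF_Iic]
    rcases le_or_gt z 0 with hz | hz
    · rw [hnull hz, Set.Ioc_eq_empty hz.not_gt, Measure.restrict_empty, lintegral_zero_measure]
    · obtain ⟨k, rfl⟩ := Nat.exists_eq_add_of_le' hn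
      rw [measure_congr (hcount hz), hN.measure_le_count measurableSet_Iic
        (hΛ hz ▸ ENNReal.ofReal_ne_top), hΛ hz, ENNReal.toReal_ofReal
        (cumulativeIntensity_nonneg hlam.le hφ.le hm.le hz.le),
        setLIntegral_inverseDominantPDF hlam.le hα hφ.le hm.le k hz.le]

end PowerAxis

section Assembly

lemma integral_pos_of_ae_pos {E : Type*} [MeasurableSpace E] {μ : Measure E} [NeZero μ]
    {f : E → ℝ} (hpos : ∀ᵐ a ∂μ, 0 < f a) (hint : Integrable f μ) : 0 < ∫ a, f a ∂μ := by
  have hsupp : Function.support f =ᵐ[μ] Set.univ :=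
    Filter.eventuallyEq_univ.2 (hpos.mono fun _ ha => ha.ne')
  rw [integral_pos_iff_support_of_nonneg_ae (hpos.mono fun _ => le_of_lt) hint,
    measure_congr hsupp]
  exact Measure.measure_univ_pos.2 (NeZero.ne μ)

variable {Ω : Type*} [MeasurableSpace Ω] {P : Measure Ω} [IsProbabilityMeasure P]
  {lam α φ : ℝ} (x : EuclideanSpace ℝ (Fin 2)) {X : ℕ → Ω → EuclideanSpace ℝ (Fin 2)}
  {μh : Measure ℝ} {h : ℕ → Ω → ℝ}

theorem isPoissonPointProcess_powerAxisProcess [IsProbabilityMeasure μh]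
    (hlam : 0 ≤ lam) (hα : 0 < α) (hφ : 0 ≤ φ) (hφ' : φ ≤ 2 * Real.pi)
    (hXm : ∀ i, Measurable (X i))
    (hX : IsPoissonPointProcess (fun ω => countingMeasure fun i => X i ω)
      (ENNReal.ofReal lam • volume) P)
    (hhm : ∀ i, Measurable (h i)) (hlaw : ∀ i, HasLaw (h i) μh P) (hindep : iIndepFun h P)
    (hXh : IndepFun (fun ω i => X i ω) (fun ω i => h i ω) P)
    (hpos : ∀ᵐ g ∂μh, 0 < g) (hint : Integrable (fun g => g ^ (2 / α)) μh) :
    IsPoissonPointProcess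
      (fun ω => powerAxisProcess α φ x (fun i => X i ω) (fun i => h i ω))
      (powerAxisIntensity lam α φ (∫ g, g ^ (2 / α) ∂μh)) P := by
  have : SigmaFinite (ENNReal.ofReal lam • volume : Measure (EuclideanSpace ℝ (Fin 2))) :=
    SMul.sigmaFinite lam.toNNReal
  simp_rw [← map_restrict_sector x hlam hα hφ hφ' hpos hint, powerAxisProcess_eq_map_restrict]
  exact ((hX.marked hXm hhm hlaw hindep hXh).restrict (measurableSet_sector x)).map (by fun_prop)

end Assembly

theorem theorem1_general {Ω : Type*} [MeasurableSpace Ω] (P : Measure Ω) [IsProbabilityMeasure P]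
    (lam α φ : ℝ) (hlam : 0 < lam) (hα : 0 < α) (hφ : 0 < φ) (hφ' : φ ≤ 2 * Real.pi)
    (x : EuclideanSpace ℝ (Fin 2))
    (X : ℕ → Ω → EuclideanSpace ℝ (Fin 2)) (hXm : ∀ i, Measurable (X i))
    (hX : IsPoissonPointProcess (fun ω => countingMeasure fun i => X i ω)
      (ENNReal.ofReal lam • volume) P)
    (μh : Measure ℝ) (h : ℕ → Ω → ℝ) (hhm : ∀ i, Measurable (h i))
    (hlaw : ∀ i, HasLaw (h i) μh P) (hindep : iIndepFun h P)
    (hXh : IndepFun (fun ω i => X i ω) (fun ω i => h i ω) P)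
    (hpos : ∀ᵐ g ∂μh, 0 < g) (hint : Integrable (fun g => g ^ (2 / α)) μh) :
    (∀ᵐ ω ∂P,
      Set.InjOn (fun i => interferencePower α x (X i ω) (h i ω))
          (interferers φ x fun i => X i ω) ∧
        StrictAntiOn (dominantPower α φ x (fun i => X i ω) (fun i => h i ω)) (Set.Ici 1) ∧
        dominantPower α φ x (fun i => X i ω) (fun i => h i ω) '' Set.Ici 1 =
          (fun i => interferencePower α x (X i ω) (h i ω)) ''
            (interferers φ x fun i => X i ω)) ∧
    (∀ n : ℕ, 1 ≤ n →
      HasLaw (fun ω => (dominantPower α φ x (fun i => X i ω) (fun i => h i ω) n)⁻¹)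
        (volume.withDensity fun z =>
          ENNReal.ofReal (inverseDominantPDF lam α φ (∫ g, g ^ (2 / α) ∂μh) n z)) P) ∧
    IsPoissonPointProcess
      (fun ω => powerAxisProcess α φ x (fun i => X i ω) (fun i => h i ω))
      (powerAxisIntensity lam α φ (∫ g, g ^ (2 / α) ∂μh)) P ∧
    (∀ z : ℝ, 0 ≤ z →
      powerAxisIntensity lam α φ (∫ g, g ^ (2 / α) ∂μh) (Set.Icc 0 z) =
        ENNReal.ofReal (cumulativeIntensity lam α φ (∫ g, g ^ (2 / α) ∂μh) z)) := by
  have : IsProbabilityMeasure μh := (hlaw 0).isProbabilityMeasure_iff.1 inferInstance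
  have hm : 0 < ∫ g, g ^ (2 / α) ∂μh :=
    integral_pos_of_ae_pos (hpos.mono fun g hg => Real.rpow_pos_of_pos hg _) hint
  have hN := isPoissonPointProcess_powerAxisProcess x hlam.le hα hφ.le hφ' hXm hX hhm hlaw hindep
    hXh hpos hint
  refine ⟨?_, fun n hn => hasLaw_inv_dominantPower hlam hα hφ hm hXm hhm hN hn, hN,
    fun z hz => powerAxisIntensity_Icc hlam.le hα hφ.le hm.le hz⟩
  filter_upwards [ae_isRankable hlam hα hφ hm hXm hhm hN] with ω hω
  exact ⟨hω.injOn, hω.strictAntiOn_dominantPower, hω.image_dominantPower⟩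

theorem theorem1 {Ω : Type*} [MeasurableSpace Ω] (P : Measure Ω) [IsProbabilityMeasure P]
    (lam α φ : ℝ) (hlam : 0 < lam) (hα : 2 < α) (hφ : 0 < φ) (hφ' : φ ≤ 2 * Real.pi)
    (x : EuclideanSpace ℝ (Fin 2))
    -- the nodes: a homogeneous Poisson point process of intensity `lam` in the plane
    (X : ℕ → Ω → EuclideanSpace ℝ (Fin 2)) (hXm : ∀ i, Measurable (X i))
    (hX : IsPoissonPointProcess (fun ω => countingMeasure fun i => X i ω)
      (ENNReal.ofReal lam • volume) P)
    -- the channel gains: positive, i.i.d. with law `μh`, independent of the nodes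
    (μh : Measure ℝ) (h : ℕ → Ω → ℝ) (hhm : ∀ i, Measurable (h i))
    (hlaw : ∀ i, HasLaw (h i) μh P) (hindep : iIndepFun h P)
    (hXh : IndepFun (fun ω i => X i ω) (fun ω i => h i ω) P)
    (hpos : ∀ᵐ g ∂μh, 0 < g) (hint : Integrable (fun g => g ^ (2 / α)) μh) :
    -- almost surely the interference powers have no ties and are listed by `I₁ > I₂ > ⋯`
    (∀ᵐ ω ∂P,
      Set.InjOn (fun i => interferencePower α x (X i ω) (h i ω))
          (interferers φ x fun i => X i ω) ∧
        StrictAntiOn (dominantPower α φ x (fun i => X i ω) (fun i => h i ω)) (Set.Ici 1) ∧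
        dominantPower α φ x (fun i => X i ω) (fun i => h i ω) '' Set.Ici 1 =
          (fun i => interferencePower α x (X i ω) (h i ω)) ''
            (interferers φ x fun i => X i ω)) ∧
    -- the density of `zₙ = Iₙ⁻¹`
    (∀ n : ℕ, 1 ≤ n →
      HasLaw (fun ω => (dominantPower α φ x (fun i => X i ω) (fun i => h i ω) n)⁻¹)
        (volume.withDensity fun z =>
          ENNReal.ofReal (inverseDominantPDF lam α φ (∫ g, g ^ (2 / α) ∂μh) n z)) P) ∧
    -- the points `‖xᵢ - x‖ ^ α / hᵢ` form a Poisson point process with intensity measure `Λ₂`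
    IsPoissonPointProcess
      (fun ω => powerAxisProcess α φ x (fun i => X i ω) (fun i => h i ω))
      (powerAxisIntensity lam α φ (∫ g, g ^ (2 / α) ∂μh)) P ∧
    (∀ z : ℝ, 0 ≤ z →
      powerAxisIntensity lam α φ (∫ g, g ^ (2 / α) ∂μh) (Set.Icc 0 z) =
        ENNReal.ofReal (cumulativeIntensity lam α φ (∫ g, g ^ (2 / α) ∂μh) z)) :=
  theorem1_general P lam α φ hlam (two_pos.trans hα) hφ hφ' x X hXm hX μh h hhm hlaw hindep hXh
    hpos hint
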